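/- Let $k$ be an infinite field and let $d,r$ be positive integers with $r\le P(d)$, the number of partitions of $d$. Notation, for $n\ge d$ with $\operatorname{char} k=0$ or $\operatorname{char} k>n$. Let $R=k[x_1,\dots,x_n]$ with $\mathfrak S_n$ permuting the variables, $R'=R^{\mathfrak S_n}$, and $\rho(f)=\frac1{n!}\sum_{\sigma}\sigma\cdot f$. Let $S=k[y_1,\dots,y_n]_{DP}$ be the divided power algebra, with $y_i$ in degree $-1$, on which $R$ acts by contraction $\circ$, and $S'=S^{\mathfrak S_n}$. $\operatorname{Gr}(r,E)$ is the set of $r$-dimensional subspaces of $E$ with the Zariski topology given by the Plücker embedding. For $V\in\operatorname{Gr}(r,R_d)$, an ideal $I$ of $R$, $U\in\operatorname{Gr}(r,R'_d)$ and a subspace $W\subseteq S'_{-d}$ put $$\alpha(V)=\rho(V),\quad \overline\alpha(I)=\rho(I_d),\quad \Phi(V)=(\sigma\cdot f:\sigma\in\mathfrak S_n,\ f\in V),$$ $$U^\perp=\{w\in S'_{-d}: u\circ w=0\ \forall u\in U\},\quad \beta(W)=\operatorname{Ann}_R(W+S_{\ge -d+1}),\quad \Psi(U)=\beta(U^\perp).$$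 For a partition $\lambda=(\lambda_1\ge\dots\ge\lambda_s)$ of $d$ let $x^\lambda=x_1^{\lambda_1}\cdots x_s^{\lambda_s}$ and $M_\lambda=\rho(x^\lambda)$. The $M_\lambda$ form a basis of $R'_d$, through which $R'_d$ is identified with $k^{P(d)}$. A monomial has type $\lambda$ if its nonzero exponents are, up to order, the parts of $\lambda$. An admissible $\lambda$-binomial is a difference $m-m'$ of two distinct monomials of type $\lambda$ such that $\gcd(m,m')$ is coprime to $m/\gcd(m,m')$ and to $m'/\gcd(m,m')$. Call $n$ large enough if $n\ge d$ and, for some total order on the partitions of $d$, the following holds for all nonzero $a\in k^{P(d)}$: let $\tau$ be the smallest partition with $a_\tau\neq0$; then for all partitions $\lambda\ne\tau$ of $d$ and all proper sub-multisets $\gamma$ of the parts of $\lambda$ (including $\gamma=\emptyset$) one can choose admissible $\lambda$-binomials $b(\lambda,\gamma)=m-m'$ with $\gcd(m,m')$ of type $\gamma$, such that no variable occurs in two of them, or in one of them and in $h_a=\sum_\lambda a_\lambda x^\lambda$. Theorem. There is a nonempty Zariski open set $\mathcal G\subseteq\operatorname{Gr}(r,k^{P(d)})$, depending only on $k,d,r$,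 such that for every $n$ that is large enough and satisfies $\operatorname{char} k=0$ or $\operatorname{char} k>n$, the following holds. Let $G\subseteq\operatorname{Gr}(r,R'_d)$ be the set that corresponds to $\mathcal G$ under the above identification, and let $$O=\{V\in\operatorname{Gr}(r,R_d):\ \dim_k\Phi(V)_d\ge\dim_k R_d-(P(d)-r)\ \text{and}\ \alpha(V)\in G\}.$$ Then $O$ and $G$ are nonempty and Zariski open in $\operatorname{Gr}(r,R_d)$ and $\operatorname{Gr}(r,R'_d)$, and 1. $\Phi(O)=\Psi(G)$; 2. $\Phi(V)=\Psi(\alpha(V))$ for all $V\in O$; 3. $\alpha$ maps $O$ onto $G$; 4. $\Psi|_G:G\to\Psi(G)$ is bijective, with inverse $\overline\alpha|_{\Psi(G)}$; 5. $O=\Phi^{-1}(\Psi(G))$, that is, for $V\in\operatorname{Gr}(r,R_d)$ one has $V\in O$ if and only if $\Phi(V)\in\Psi(G)$; 6. $U\mapsto U^\perp$ maps $G$ into $\operatorname{Gr}(P(d)-r,S'_{-d})$, and $\beta$ is injective on its image $G^\perp$. So $G$, a set independent of $n$, parametrizes the general $(r,d)$-symmetric ideals $\Phi(V)$, $V\in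 O$, one-to-one. -/

import Mathlib

namespace SymmIdeals

open MvPolynomial

/-! ### Grassmannians and their Zariski topology -/

section Grassmannian

variable {k M : Type*} [Field k] [AddCommGroup M] [Module k M]

/-- `Gr(r, E)`: the `r`-dimensional subspaces of the subspace `E` of `M`. -/
def Gr (E : Submodule k M) (r : ℕ) : Set (Submodule k M) :=
  {V | V ≤ E ∧ Module.finrank k V = r}

/-- The Plücker coordinates of the tuple `v₁, …, v_r`. For every choice of `r` linear forms
`ℓ₁, …, ℓ_r` there is the coordinate `det (ℓ_i (v_j))`. When the `ℓ_i` are taken from the dual of a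
basis these are the maximal minors of the coefficient matrix of `v`; the coordinate of an arbitrary
`ℓ` is a fixed linear combination of those. -/
def plucker {r : ℕ} (v : Fin r → M) (l : Fin r → Module.Dual k M) : k :=
  (Matrix.of fun i j => l i (v j)).det

/-- `T` is a Zariski open subset of `Gr(r, E)`: its complement in `Gr(r, E)` is the common zero
locus of a set of homogeneous polynomials in the Plücker coordinates. -/
def IsZariskiOpen (E : Submodule k M) (r : ℕ) (T : Set (Submodule k M)) : Prop :=
  T ⊆ Gr E r ∧
  ∃ F : Set (MvPolynomial (Fin r → Module.Dual k M) k),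
    (∀ f ∈ F, ∃ e : ℕ, f.IsHomogeneous e) ∧
    ∀ v : Fin r → M, (∀ i, v i ∈ E) → LinearIndependent k v →
      (Submodule.span k (Set.range v) ∈ T ↔ ∃ f ∈ F, eval (plucker v) f ≠ 0)

end Grassmannian

/-! ### The polynomial ring `R = k[x₁, …, xₙ]` with its action of the symmetric group -/

section Polynomials

variable (k : Type*) [Field k] (n d : ℕ)

/-- `R_d`, the forms of degree `d`. -/
noncomputable abbrev Rd : Submodule k (MvPolynomial (Fin n) k) :=
  homogeneousSubmodule (Fin n) k d

/-- `R'_d`, the symmetric forms of degree `d`. -/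
noncomputable def RdInv : Submodule k (MvPolynomial (Fin n) k) :=
  Rd k n d ⊓ Subalgebra.toSubmodule (symmetricSubalgebra (Fin n) k)

variable {k n}

/-- The Reynolds operator `ρ(f) = (1 / n!) ∑ σ · f`, where `σ · f = f(x_{σ(1)}, …, x_{σ(n)})`. -/
noncomputable def reynolds : MvPolynomial (Fin n) k →ₗ[k] MvPolynomial (Fin n) k :=
  ((n.factorial : k)⁻¹) • ∑ σ : Equiv.Perm (Fin n), (rename (R := k) σ).toLinearMap

/-- `α(V)`, the span of all `ρ(f)` with `f ∈ V`. -/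
noncomputable def alpha (V : Submodule k (MvPolynomial (Fin n) k)) :
    Submodule k (MvPolynomial (Fin n) k) :=
  V.map reynolds

/-- `Φ(V) = (V)_{𝔖ₙ}`, the ideal generated by all `σ · f` with `σ ∈ 𝔖ₙ` and `f ∈ V`. -/
noncomputable def Phi (V : Submodule k (MvPolynomial (Fin n) k)) :
    Ideal (MvPolynomial (Fin n) k) :=
  Ideal.span {g | ∃ σ : Equiv.Perm (Fin n), ∃ f ∈ V, g = rename σ f}

/-- `I_d = I ∩ R_d`. -/
noncomputable def degreePart (I : Ideal (MvPolynomial (Fin n) k)) :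
    Submodule k (MvPolynomial (Fin n) k) :=
  I.restrictScalars k ⊓ Rd k n d

/-- `ᾱ(I) = α(I_d)`. -/
noncomputable def alphaBar (I : Ideal (MvPolynomial (Fin n) k)) :
    Submodule k (MvPolynomial (Fin n) k) :=
  alpha (degreePart d I)

end Polynomials

/-! ### The divided power module `S` and Macaulay duality -/

section Duality

variable (k : Type*) [Field k] (n d : ℕ)

/-- The underlying vector space of the divided power algebra `S = k[y₁, …, yₙ]_{DP}`: its basis
consists of the monomials `y^(e) = y₁^(e₁) ⋯ yₙ^(eₙ)`, where `y^(e)` has degree `-(e₁ + ⋯ + eₙ)`. -/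
abbrev DP : Type _ := (Fin n →₀ ℕ) →₀ k

variable {n}

/-- Contraction by `x^a`: it sends `y^(e)` to `y^(e - a)` if `a ≤ e` and to `0` otherwise. -/
noncomputable def contractMonomial (a : Fin n →₀ ℕ) : DP k n →ₗ[k] DP k n :=
  open scoped Classical in
  Finsupp.linearCombination k
    fun e : Fin n →₀ ℕ => if a ≤ e then Finsupp.single (e - a) (1 : k) else 0

theorem contractMonomial_single (a e : Fin n →₀ ℕ) (c : k) [Decidable (a ≤ e)] :
    contractMonomial k a (Finsupp.single e c) =
      if a ≤ e then Finsupp.single (e - a) c else 0 := by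
  classical
  by_cases h : a ≤ e <;> simp [contractMonomial, h]

theorem contractMonomial_zero : contractMonomial k (0 : Fin n →₀ ℕ) = 1 := by
  classical
  refine Finsupp.lhom_ext fun e c => ?_
  simp [contractMonomial_single]

theorem contractMonomial_add (a b : Fin n →₀ ℕ) :
    contractMonomial k (a + b) = contractMonomial k a * contractMonomial k b := by
  classical
  refine Finsupp.lhom_ext fun e c => ?_
  rw [Module.End.mul_apply, contractMonomial_single, contractMonomial_single]
  by_cases hb : b ≤ e
  · rw [if_pos hb, contractMonomial_single]
    have h1 : a ≤ e - b ↔ a + b ≤ e := le_tsub_iff_right hb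
    have h2 : e - b - a = e - (a + b) := by rw [tsub_tsub, add_comm]
    simp only [h1, h2]
  · have : ¬ a + b ≤ e := fun h => hb (le_trans le_add_self h)
    simp [hb, this]

/-- The contraction action of `R` on `S`, `f ∘ g = contraction k f g`: the bilinear extension of
the contraction by monomials. -/
noncomputable def contraction : MvPolynomial (Fin n) k →ₐ[k] Module.End k (DP k n) :=
  AddMonoidAlgebra.lift k (Module.End k (DP k n)) (Fin n →₀ ℕ)
    { toFun := fun a => contractMonomial k a.toAdd
      map_one' := contractMonomial_zero k
      map_mul' := fun a b => contractMonomial_add k a.toAdd b.toAdd }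

variable (n)

/-- `S'_{-d}`: the elements of degree `-d` of `S` that are invariant under all the permutations
`σ · g = g(y_{σ(1)}, …, y_{σ(n)})`. -/
def DPInv : Submodule k (DP k n) where
  carrier := {g | g ∈ Finsupp.supported k k {e : Fin n →₀ ℕ | e.degree = d} ∧
    ∀ σ : Equiv.Perm (Fin n), Finsupp.lmapDomain k k (Finsupp.mapDomain σ) g = g}
  add_mem' := fun ha hb =>
    ⟨Submodule.add_mem _ ha.1 hb.1, fun σ => by rw [map_add, ha.2 σ, hb.2 σ]⟩
  zero_mem' := ⟨Submodule.zero_mem _, fun σ => map_zero _⟩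
  smul_mem' := fun c _ ha => ⟨Submodule.smul_mem _ c ha.1, fun σ => by rw [map_smul, ha.2 σ]⟩

/-- `S_{≥ -d+1}`, the span of the monomials `y^(e)` with `-(e₁ + ⋯ + eₙ) ≥ -d + 1`. -/
noncomputable def DPGe : Submodule k (DP k n) :=
  Finsupp.supported k k {e : Fin n →₀ ℕ | e.degree < d}

variable {k n}

/-- `Ann_R(N)`. -/
noncomputable def annR (N : Submodule k (DP k n)) : Ideal (MvPolynomial (Fin n) k) where
  carrier := {f | ∀ g ∈ N, contraction k f g = 0}
  add_mem' := fun ha hb g hg => by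
    rw [map_add, LinearMap.add_apply, ha g hg, hb g hg, add_zero]
  zero_mem' := fun g _ => by rw [map_zero, LinearMap.zero_apply]
  smul_mem' := fun c f hf g hg => by
    rw [smul_eq_mul, map_mul, Module.End.mul_apply, hf g hg, map_zero]

/-- `U^⊥ = {w ∈ S'_{-d} : u ∘ w = 0 for all u ∈ U}`. -/
def perp (U : Submodule k (MvPolynomial (Fin n) k)) : Submodule k (DP k n) where
  carrier := {w | w ∈ DPInv k n d ∧ ∀ u ∈ U, contraction k u w = 0}
  add_mem' := fun ha hb =>
    ⟨Submodule.add_mem _ ha.1 hb.1, fun u hu => by rw [map_add, ha.2 u hu, hb.2 u hu, add_zero]⟩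
  zero_mem' := ⟨Submodule.zero_mem _, fun _ _ => map_zero _⟩
  smul_mem' := fun c _ ha =>
    ⟨Submodule.smul_mem _ c ha.1, fun u hu => by rw [map_smul, ha.2 u hu, smul_zero]⟩

/-- `β(W) = Ann_R(W + S_{≥ -d+1})`. -/
noncomputable def beta (W : Submodule k (DP k n)) : Ideal (MvPolynomial (Fin n) k) :=
  annR (W ⊔ DPGe k n d)

/-- `Ψ(U) = Ann_R(U^⊥ + S_{≥ -d+1})`. -/
noncomputable def Psi (U : Submodule k (MvPolynomial (Fin n) k)) :
    Ideal (MvPolynomial (Fin n) k) :=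
  beta d (perp d U)

end Duality

/-! ### Partitions, the basis `M_λ` of `R'_d`, and the auxiliary forms `f_α` -/

section Partitions

variable {d n : ℕ}

/-- `P(d)`, the number of partitions of `d`. -/
def P (d : ℕ) : ℕ := Fintype.card d.Partition

/-- The exponent of `x^λ = x₁^{λ₁} ⋯ x_s^{λ_s}`, where `λ₁ ≥ ⋯ ≥ λ_s` are the parts of `λ`
(for `s ≤ n`). -/
noncomputable def partExponent (n : ℕ) (p : d.Partition) : Fin n →₀ ℕ :=
  Finsupp.equivFunOnFinite.symm fun i => (p.parts.sort (· ≥ ·)).getD i 0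

/-- The type of a monomial, as the multiset of its nonzero exponents. -/
def monomialType (m : Fin n →₀ ℕ) : Multiset ℕ := m.support.val.map m

/-- `x^m - x^m'` is an admissible `λ`-binomial: `m ≠ m'` are monomials of type `λ`, and their
greatest common divisor is coprime to the two complementary factors. -/
def IsAdmissibleBinomial (p : d.Partition) (m m' : Fin n →₀ ℕ) : Prop :=
  m ≠ m' ∧ monomialType m = p.parts ∧ monomialType m' = p.parts ∧
  Disjoint (m ⊓ m').support (m - m ⊓ m').support ∧
  Disjoint (m ⊓ m').support (m' - m ⊓ m').support

variable (k : Type*) [Field k]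

/-- `∑ α_λ M_λ`, where `M_λ = ρ(x^λ)`. For `d ≤ n`, if the characteristic of `k` is zero or greater
than `n`, this identifies `k^{P(d)}` with `R'_d`. -/
noncomputable def coordMap (d n : ℕ) : (d.Partition → k) →ₗ[k] MvPolynomial (Fin n) k :=
  ∑ p : d.Partition,
    (LinearMap.proj p).smulRight (reynolds (monomial (partExponent n p) (1 : k)))

variable {k}

/-- `h_α = ∑ α_λ x^λ`. -/
noncomputable def hPoly (n : ℕ) (a : d.Partition → k) : MvPolynomial (Fin n) k :=
  ∑ p : d.Partition, monomial (partExponent n p) (a p)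

/-- For `h_α` and the partition `τ` there is a choice, for all partitions `λ ≠ τ` of `d` and all
proper subpartitions `γ` of `λ` (the empty one included), of an admissible `λ`-binomial
`b(λ, γ) = x^m - x^m'`, `(m, m') = b λ γ`, whose greatest common divisor `gcd(x^m, x^m')` has type
`γ`, such that the variables in `b(λ, γ)` do not occur in `h_α` and no variable occurs in two of the
binomials. -/
def HasBinomials (n : ℕ) (a : d.Partition → k) (t : d.Partition) : Prop :=
  ∃ b : d.Partition → Multiset ℕ → (Fin n →₀ ℕ) × (Fin n →₀ ℕ),
    (∀ p, p ≠ t → ∀ c, c < p.parts →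
      IsAdmissibleBinomial p (b p c).1 (b p c).2 ∧
      monomialType ((b p c).1 ⊓ (b p c).2) = c ∧
      Disjoint ((b p c).1.support ∪ (b p c).2.support) (hPoly n a).vars) ∧
    (∀ p, p ≠ t → ∀ c, c < p.parts → ∀ p', p' ≠ t → ∀ c', c' < p'.parts → (p, c) ≠ (p', c') →
      Disjoint ((b p c).1.support ∪ (b p c).2.support)
        ((b p' c').1.support ∪ (b p' c').2.support))

variable (k)

/-- The number `n` of variables is large enough: all monomials `x^λ` exist, and for a suitable total
order on the partitions of `d` and all `α ≠ 0`, the binomials needed to write down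
`f_α = h_α + ∑_{λ ≠ τ} ∑_{γ ⊊ λ} b(λ, γ)` can be chosen, `τ` being smallest with `α_τ ≠ 0`. -/
def EnoughVariables (d n : ℕ) : Prop :=
  d ≤ n ∧
  ∃ lt : d.Partition → d.Partition → Prop, IsStrictTotalOrder d.Partition lt ∧
    ∀ (a : d.Partition → k) (t : d.Partition),
      a t ≠ 0 → (∀ p, a p ≠ 0 → ¬ lt p t) → HasBinomials n a t

end Partitions

end SymmIdeals

namespace SymmIdeals

open MvPolynomial

/-! ### Open conditions on Grassmannians, written in Plücker coordinates. -/

section Grassmannian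

variable {k M N : Type*} [Field k] [AddCommGroup M] [Module k M] [AddCommGroup N] [Module k N]

/-! Everything is read off from `typeSum`, which adds up the coefficients of a form over each orbit
of monomials of degree `d`. It is invariant under permutations, inverts `coordMap`, and turns the
Reynolds operator into `coordMap ∘ typeSum`. So `alpha V` corresponds to `A = typeSum(V)`. Dually,
the invariants of degree `-d` are the functionals on `k^{P(d)}` composed with `typeSum`
(`dualForm`), and a double annihilator argument shows that the ideal `Psi` of the subspace given by
`A` consists of the polynomials without terms below degree `d` whose type sums lie in `A`
(`mem_Psi_map_coordMap`). Its degree `d` part `typeComap n A` has codimension `P(d) - dim A` in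
`R_d` and determines `A`; this gives the injectivity of `Psi` and its inverse.

The degree `d` part of `Phi V` is the span of the orbit of `V` and lies in `typeComap n A`. When
`dim A = r`, the dimension bound defining `O` forces equality there. Above degree `d` one needs
every monomial of degree `d + 1`. Modulo the binomials in `typeComap n A` these monomials all
coincide if `n ≥ 3`, so multiplying a form by a variable leaves its total coefficient sum times that
common class. Hence `𝒢` is taken to be the set of subspaces on which the coordinate sum is not
identically zero, a condition that does not involve `n`.

It remains to see that `alpha` reaches all of `G`. Given nonzero `a ∈ A`, the form `h_a` plus
disjoint admissible binomials has type sum `a`. Swapping the two exchanged variables of one binomial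
isolates that binomial, and from the isolated binomials the orbit of the form yields all differences
within orbits (`HasBinomials.exists_generator`). Lifting `A` to `R_d` by a linear section through
this form gives the required `V` (`exists_mem_Gr_of_mem_Gr`). -/

theorem exists_dual_family {ι : Type*} [Fintype ι] [DecidableEq ι] {v : ι → M}
    (hv : LinearIndependent k v) :
    ∃ l : ι → Module.Dual k M, ∀ i j, l i (v j) = if i = j then 1 else 0 := by
  obtain ⟨g, hg⟩ := LinearMap.exists_leftInverse_of_injective (Fintype.linearCombination k v)
    (LinearMap.ker_eq_bot.2 (linearIndependent_iff_injective_fintypeLinearCombination.1 hv))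
  refine ⟨fun i => LinearMap.proj i ∘ₗ g, fun i j => ?_⟩
  have h := LinearMap.congr_fun hg (Pi.single j 1)
  simp only [LinearMap.comp_apply, LinearMap.id_apply, Fintype.linearCombination_apply_single,
    one_smul] at h
  simp [h, Pi.single_apply]

theorem linearIndependent_iff_exists_plucker_ne_zero {r : ℕ} {v : Fin r → M} :
    LinearIndependent k v ↔ ∃ l : Fin r → Module.Dual k M, plucker v l ≠ 0 := by
  constructor
  · intro hv
    obtain ⟨l, hl⟩ := exists_dual_family hv
    refine ⟨l, ?_⟩
    have : (Matrix.of fun i j => l i (v j)) = 1 := by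
      ext i j
      simp [hl, Matrix.one_apply]
    simp [plucker, this]
  · rintro ⟨l, hl⟩
    rw [Fintype.linearIndependent_iff]
    intro g hg
    have h0 : (Matrix.of fun i j => l i (v j)).mulVec g = 0 := by
      ext i
      have := congrArg (l i) hg
      simpa [Matrix.mulVec, dotProduct, mul_comm] using this
    have := Matrix.eq_zero_of_mulVec_eq_zero hl h0
    exact fun i => congrFun this i

/-- The vector of `span v` whose pairing with a linear form `f` is the Plücker coordinate
of `l` with its `i`-th entry replaced by `f`. -/
noncomputable def cramerVector {r : ℕ} (v : Fin r → M) (l : Fin r → Module.Dual k M)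
    (i : Fin r) : M :=
  ∑ j, (Matrix.of fun i j => l i (v j)).adjugate j i • v j

/-- Cramer's rule: expand the determinant along the row that has been replaced by `f`. -/
theorem apply_cramerVector {r : ℕ} (v : Fin r → M) (l : Fin r → Module.Dual k M) (i : Fin r)
    (f : Module.Dual k M) : f (cramerVector v l i) = plucker v (Function.update l i f) := by
  set A : Matrix (Fin r) (Fin r) k := Matrix.of fun i j => l i (v j) with hA
  have h1 : (Matrix.of fun a b => (Function.update l i f) a (v b)) =
      A.updateRow i fun j => f (v j) := by
    ext a b
    by_cases h : a = i
    · subst h; simp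
    · simp [h, hA]
  rw [plucker, h1, ← Matrix.cramer_transpose_apply, Matrix.cramer_eq_adjugate_mulVec,
    ← Matrix.adjugate_transpose]
  simp [cramerVector, Matrix.mulVec, dotProduct, ← hA]

/-- This gives generators of a subspace whose pairings with linear forms are themselves Plücker
coordinates. When `l` is dual to `v` the matrix is the identity and the Cramer vectors are the `v
i`. -/
theorem span_range_cramerVector {r : ℕ} {v : Fin r → M} (hv : LinearIndependent k v) :
    Submodule.span k (Set.range fun p : (Fin r → Module.Dual k M) × Fin r =>
      cramerVector v p.1 p.2) = Submodule.span k (Set.range v) := by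
  apply le_antisymm
  · rw [Submodule.span_le]
    rintro _ ⟨p, rfl⟩
    exact Submodule.sum_mem _ fun j _ =>
      Submodule.smul_mem _ _ (Submodule.subset_span ⟨j, rfl⟩)
  · rw [Submodule.span_le]
    rintro _ ⟨i, rfl⟩
    obtain ⟨l, hl⟩ := exists_dual_family hv
    refine Submodule.subset_span ⟨(l, i), ?_⟩
    have : (Matrix.of fun i j => l i (v j)) = 1 := by
      ext i j
      simp [hl, Matrix.one_apply]
    simp [cramerVector, this, Matrix.one_apply]

theorem le_finrank_span_range_iff {ι : Type*} (w : ι → M) (m : ℕ)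
    [FiniteDimensional k (Submodule.span k (Set.range w))] :
    m ≤ Module.finrank k (Submodule.span k (Set.range w)) ↔
      ∃ q : Fin m → ι, LinearIndependent k (w ∘ q) := by
  constructor
  · intro h
    obtain ⟨f, hf, -, hi⟩ := Submodule.exists_fun_fin_finrank_span_eq k (Set.range w)
    choose q hq using hf
    refine ⟨fun a => q (Fin.castLE h a), ?_⟩
    have : (w ∘ fun a => q (Fin.castLE h a)) = f ∘ Fin.castLE h := by
      ext a
      simp [hq]
    rw [this]
    exact hi.comp _ (Fin.castLE_injective h)
  · rintro ⟨q, hq⟩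
    have h := finrank_span_eq_card hq
    rw [Fintype.card_fin] at h
    rw [← h]
    exact Submodule.finrank_mono (Submodule.span_mono (Set.range_comp_subset_range q w))

theorem span_range_mem_Gr {E : Submodule k M} {r : ℕ} {v : Fin r → M}
    (hE : ∀ i, v i ∈ E) (hv : LinearIndependent k v) :
    Submodule.span k (Set.range v) ∈ Gr E r := by
  refine ⟨?_, ?_⟩
  · rw [Submodule.span_le]
    rintro _ ⟨i, rfl⟩
    exact hE i
  · simpa using finrank_span_eq_card hv

theorem IsZariskiOpen.inter {E : Submodule k M} {r : ℕ} {S T : Set (Submodule k M)}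
    (hS : IsZariskiOpen E r S) (hT : IsZariskiOpen E r T) : IsZariskiOpen E r (S ∩ T) := by
  obtain ⟨hS1, F, hF, hF'⟩ := hS
  obtain ⟨-, G, hG, hG'⟩ := hT
  refine ⟨Set.inter_subset_left.trans hS1, {p | ∃ f ∈ F, ∃ g ∈ G, p = f * g}, ?_, ?_⟩
  · rintro _ ⟨f, hf, g, hg, rfl⟩
    obtain ⟨a, ha⟩ := hF f hf
    obtain ⟨b, hb⟩ := hG g hg
    exact ⟨a + b, ha.mul hb⟩
  · intro v hv hi
    rw [Set.mem_inter_iff, hF' v hv hi, hG' v hv hi]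
    constructor
    · rintro ⟨⟨f, hf, hf0⟩, g, hg, hg0⟩
      exact ⟨_, ⟨f, hf, g, hg, rfl⟩, by simp [hf0, hg0]⟩
    · rintro ⟨_, ⟨f, hf, g, hg, rfl⟩, h⟩
      rw [map_mul] at h
      exact ⟨⟨f, hf, left_ne_zero_of_mul h⟩, g, hg, right_ne_zero_of_mul h⟩

theorem isHomogeneous_det {σ R : Type*} [CommRing R] {m : ℕ}
    (A : Matrix (Fin m) (Fin m) (MvPolynomial σ R)) (hA : ∀ i j, (A i j).IsHomogeneous 1) :
    A.det.IsHomogeneous m := by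
  rw [Matrix.det_apply]
  refine IsHomogeneous.sum _ _ _ fun g _ => ?_
  have h := IsHomogeneous.prod Finset.univ (fun i => A (g i) i) (fun _ => 1) fun i _ => hA _ _
  rw [Finset.sum_const, Finset.card_univ, Fintype.card_fin, smul_eq_mul, mul_one] at h
  rcases Int.units_eq_one_or (Equiv.Perm.sign g) with hs | hs
  · simpa [hs] using h
  · simpa [hs] using h.neg

/-- For finitely many linear maps `T j`, the condition `m ≤ dim ∑ T_j(V)` on `V` is open. -/
theorem isZariskiOpen_le_finrank_iSup_map {J : Type*} [Finite J] (E : Submodule k M) (r : ℕ)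
    (T : J → M →ₗ[k] N) (m : ℕ) :
    IsZariskiOpen E r {V | V ∈ Gr E r ∧ m ≤ Module.finrank k (⨆ j, V.map (T j) :)} := by
  -- The equations are the `m × m` minors of the matrix pairing forms `g a` with images under `T j`
  -- of Cramer vectors. Each entry is a single Plücker coordinate, hence a variable, so each minor
  -- is homogeneous of degree `m`.
  refine ⟨fun V hV => hV.1,
    {f | ∃ (q : Fin m → J × ((Fin r → Module.Dual k M) × Fin r)) (g : Fin m → Module.Dual k N),
      f = (Matrix.of fun a b =>
        X (Function.update (q b).2.1 (q b).2.2 (g a ∘ₗ T (q b).1))).det}, ?_, ?_⟩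
  · rintro _ ⟨q, g, rfl⟩
    exact ⟨m, isHomogeneous_det _ fun i j => isHomogeneous_X _ _⟩
  · intro v hv hi
    have hspan : (⨆ j, (Submodule.span k (Set.range v)).map (T j)) =
        Submodule.span k (Set.range fun p : J × ((Fin r → Module.Dual k M) × Fin r) =>
          T p.1 (cramerVector v p.2.1 p.2.2)) := by
      rw [← span_range_cramerVector hi]
      simp_rw [Submodule.map_span, ← Submodule.span_iUnion]
      congr 1
      ext x
      simp
    have : FiniteDimensional k (Submodule.span k (Set.range v)) :=
      FiniteDimensional.span_of_finite k (Set.finite_range v)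
    have hfin : FiniteDimensional k (⨆ j, (Submodule.span k (Set.range v)).map (T j) :) :=
      inferInstance
    rw [Set.mem_ofPred_eq, and_iff_right (span_range_mem_Gr hv hi)]
    rw [hspan] at hfin ⊢
    rw [le_finrank_span_range_iff]
    constructor
    · rintro ⟨q, hq⟩
      obtain ⟨g, hg⟩ := linearIndependent_iff_exists_plucker_ne_zero.1 hq
      refine ⟨_, ⟨q, g, rfl⟩, ?_⟩
      rw [RingHom.map_det]
      convert hg using 1
      refine congrArg Matrix.det (Matrix.ext fun a b => ?_)
      simp [← apply_cramerVector]
    · rintro ⟨_, ⟨q, g, rfl⟩, h⟩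
      refine ⟨q, linearIndependent_iff_exists_plucker_ne_zero.2 ⟨g, ?_⟩⟩
      rw [RingHom.map_det] at h
      convert h using 1
      refine congrArg Matrix.det (Matrix.ext fun a b => ?_)
      simp [← apply_cramerVector]

/-- Being nonzero on `V` means that the image of `V` under `s` has dimension at least one. -/
theorem isZariskiOpen_exists_apply_ne_zero (E : Submodule k M) (r : ℕ) (s : M →ₗ[k] k) :
    IsZariskiOpen E r {V | V ∈ Gr E r ∧ ∃ a ∈ V, s a ≠ 0} := by
  convert isZariskiOpen_le_finrank_iSup_map E r (fun _ : Unit => s) 1 using 4 with V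
  rw [iSup_unique, Nat.one_le_iff_ne_zero, Ne, Submodule.finrank_eq_zero, ← LinearMap.le_ker_iff_map]
  simp [SetLike.le_def]

end Grassmannian

/-! ### Types of monomials and orbits of exponents. -/

section Types

variable {n d : ℕ}

theorem monomialType_eq_filter (e : Fin n →₀ ℕ) :
    monomialType e = (Finset.univ.val.map e).filter (· ≠ 0) := by
  rw [monomialType, Multiset.filter_map]
  congr 1
  have : e.support = Finset.univ.filter fun i => e i ≠ 0 := by
    ext i
    simp
  rw [this]
  rfl

theorem monomialType_mapDomain (σ : Equiv.Perm (Fin n)) (e : Fin n →₀ ℕ) :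
    monomialType (e.mapDomain σ) = monomialType e := by
  classical
  rw [monomialType, Finsupp.mapDomain_support_of_injective σ.injective,
    Finset.image_val_of_injOn σ.injective.injOn, Multiset.map_map]
  refine Multiset.map_congr rfl fun i _ => ?_
  simp [Finsupp.mapDomain_apply σ.injective]

theorem sum_monomialType (e : Fin n →₀ ℕ) : (monomialType e).sum = e.degree := rfl

theorem card_monomialType (e : Fin n →₀ ℕ) : (monomialType e).card = e.support.card := by
  simp [monomialType]

theorem monomialType_add {e f : Fin n →₀ ℕ} (h : Disjoint e.support f.support) :
    monomialType (e + f) = monomialType e + monomialType f := by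
  classical
  rw [monomialType, Finsupp.support_add_eq h, ← Finset.disjUnion_eq_union _ _ h]
  simp only [Finset.disjUnion_val, Multiset.map_add, monomialType]
  congr 1
  · refine Multiset.map_congr rfl fun i hi => ?_
    have : f i = 0 := Finsupp.notMem_support_iff.1 (Finset.disjoint_left.1 h hi)
    simp [this]
  · refine Multiset.map_congr rfl fun i hi => ?_
    have : e i = 0 := Finsupp.notMem_support_iff.1 (Finset.disjoint_right.1 h hi)
    simp [this]

/-- The type counts how often each nonzero exponent occurs, and `n` then fixes the number of zeros.
So corresponding fibres of `e` and `e'` have equal size, and bijections between them glue to a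
permutation. -/
theorem exists_mapDomain_eq {e e' : Fin n →₀ ℕ} (h : monomialType e = monomialType e') :
    ∃ σ : Equiv.Perm (Fin n), e.mapDomain σ = e' := by
  classical
  have hne : ∀ c, c ≠ 0 → Fintype.card {i // e i = c} = Fintype.card {i // e' i = c} := by
    intro c hc
    have key : ∀ f : Fin n →₀ ℕ,
        Fintype.card {i // f i = c} = Multiset.count c (monomialType f) := by
      intro f
      rw [monomialType_eq_filter, Multiset.count_filter_of_pos (p := (· ≠ 0)) hc, Multiset.count_map,
        Fintype.card_subtype]
      simp only [eq_comm (a := c)]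
      rfl
    rw [key, key, h]
  have hzero : Fintype.card {i // e i = 0} = Fintype.card {i // e' i = 0} := by
    have key : ∀ f : Fin n →₀ ℕ,
        Fintype.card {i // f i = 0} = n - Multiset.card (monomialType f) := by
      intro f
      have h1 := Fintype.card_subtype_compl fun i => f i ≠ 0
      have h2 : Fintype.card {i // f i ≠ 0} = f.support.card := by
        rw [Fintype.card_subtype]
        congr 1
        ext i
        simp
      rw [h2, Fintype.card_fin] at h1
      rw [card_monomialType, ← h1]
      exact Fintype.card_congr (Equiv.subtypeEquivRight fun i => by simp)
    rw [key, key, h]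
  have hall : ∀ c, Nonempty ({i // e i = c} ≃ {i // e' i = c}) := fun c => by
    rw [← Fintype.card_eq]
    by_cases hc : c = 0
    · subst hc; exact hzero
    · exact hne c hc
  let E := fun c => (hall c).some
  let σ : Equiv.Perm (Fin n) := (Equiv.sigmaFiberEquiv e).symm.trans
    ((Equiv.sigmaCongrRight E).trans (Equiv.sigmaFiberEquiv e'))
  have hσ : ∀ i, e' (σ i) = e i := fun i => (E (e i) ⟨i, rfl⟩).2
  refine ⟨σ, Finsupp.ext fun j => ?_⟩
  obtain ⟨i, rfl⟩ := σ.surjective j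
  rw [Finsupp.mapDomain_apply σ.injective, hσ]

theorem card_parts_le (p : d.Partition) : p.parts.card ≤ d := by
  have h := Multiset.card_nsmul_le_sum (s := p.parts) (a := 1) fun x hx => p.parts_pos hx
  rwa [p.parts_sum, smul_eq_mul, mul_one] at h

theorem monomialType_partExponent (hdn : d ≤ n) (p : d.Partition) :
    monomialType (partExponent n p) = p.parts := by
  set L := p.parts.sort (· ≥ ·) with hL
  have hLp : (L : Multiset ℕ) = p.parts := Multiset.sort_eq _ _
  have hlen : L.length ≤ n := by
    have : L.length = p.parts.card := by simp [hL]
    exact this ▸ (card_parts_le p).trans hdn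
  have h0 : ∀ x ∈ L, x ≠ 0 := fun x hx => by
    have : x ∈ p.parts := by rw [← hLp]; exact hx
    exact (p.parts_pos this).ne'
  -- The default value `0` of `getD` pads the list of parts to length `n`; these zeros are then
  -- filtered out of the type.
  have h1 : List.ofFn (fun i : Fin n => L.getD i 0) = L ++ List.replicate (n - L.length) 0 := by
    apply List.ext_getElem
    · simp; omega
    · intro i h1 h2
      by_cases hi : i < L.length
      · simp [hi]
      · simp [List.getElem_append, hi]
  have h2 : Finset.univ.val.map (partExponent n p) =
      ((List.ofFn fun i : Fin n => L.getD i 0 : List ℕ) : Multiset ℕ) := by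
    rw [List.ofFn_eq_map]
    rfl
  rw [monomialType_eq_filter, h2, h1, Multiset.filter_coe, List.filter_append, ← hLp]
  have h3 : L.filter (fun x => decide (x ≠ 0)) = L := List.filter_eq_self.2 (by simpa using h0)
  rw [h3]
  simp

theorem degree_partExponent (hdn : d ≤ n) (p : d.Partition) : (partExponent n p).degree = d := by
  rw [← sum_monomialType, monomialType_partExponent hdn, p.parts_sum]

theorem degree_eq_of_monomialType {e : Fin n →₀ ℕ} {p : d.Partition}
    (h : monomialType e = p.parts) : e.degree = d := by
  rw [← sum_monomialType, h, p.parts_sum]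

theorem exists_partition {e : Fin n →₀ ℕ} (h : e.degree = d) :
    ∃ p : d.Partition, monomialType e = p.parts := by
  refine ⟨⟨monomialType e, fun {i} hi => ?_, h⟩, rfl⟩
  rw [monomialType_eq_filter, Multiset.mem_filter] at hi
  exact Nat.pos_of_ne_zero hi.2

end Types

/-! ### Type sums, the Reynolds operator and the coordinates of symmetric forms. -/

section Coordinates

variable {k : Type*} [Field k] {n d : ℕ}

theorem degree_eq_of_mem_support {f : MvPolynomial (Fin n) k} (hf : f ∈ Rd k n d)
    {e : Fin n →₀ ℕ} (he : e ∈ f.support) : e.degree = d := by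
  by_contra h
  exact mem_support_iff.1 he (IsHomogeneous.coeff_eq_zero hf h)

theorem monomial_mem_Rd {e : Fin n →₀ ℕ} (he : e.degree = d) (c : k) :
    monomial e c ∈ Rd k n d :=
  isHomogeneous_monomial c he

theorem rename_mem_Rd {f : MvPolynomial (Fin n) k} (hf : f ∈ Rd k n d)
    (σ : Equiv.Perm (Fin n)) : rename σ f ∈ Rd k n d :=
  IsHomogeneous.rename_isHomogeneous (f := σ) hf

theorem Rd_le {S : Submodule k (MvPolynomial (Fin n) k)}
    (h : ∀ e : Fin n →₀ ℕ, e.degree = d → monomial e (1 : k) ∈ S) : Rd k n d ≤ S := by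
  intro f hf
  rw [f.as_sum]
  refine Submodule.sum_mem _ fun e he => ?_
  have : monomial e (coeff e f) = coeff e f • monomial e (1 : k) := by simp [smul_monomial]
  rw [this]
  exact Submodule.smul_mem _ _ (h e (degree_eq_of_mem_support hf he))

theorem eqOn_Rd {N : Type*} [AddCommGroup N] [Module k N] (A B : MvPolynomial (Fin n) k →ₗ[k] N)
    (h : ∀ e : Fin n →₀ ℕ, e.degree = d → A (monomial e 1) = B (monomial e 1))
    {f : MvPolynomial (Fin n) k} (hf : f ∈ Rd k n d) : A f = B f := by
  have : Rd k n d ≤ LinearMap.eqLocus A B := Rd_le h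
  exact this hf

/-- The sums of the coefficients of the monomials of type `λ`, for all partitions `λ` of `d`. -/
noncomputable def typeSum (d : ℕ) : MvPolynomial (Fin n) k →ₗ[k] (d.Partition → k) :=
  (basisMonomials (Fin n) k).constr k
    fun e p => if monomialType e = p.parts then 1 else 0

theorem typeSum_monomial_apply (e : Fin n →₀ ℕ) (c : k) (p : d.Partition) :
    typeSum d (monomial e c) p = if monomialType e = p.parts then c else 0 := by
  have h1 : monomial e c = c • basisMonomials (Fin n) k e := by simp [smul_monomial]
  rw [h1, map_smul, typeSum, Module.Basis.constr_basis]
  simp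

theorem typeSum_monomial {e : Fin n →₀ ℕ} {p : d.Partition} (h : monomialType e = p.parts)
    (c : k) : typeSum d (monomial e c) = Pi.single p c := by
  ext q
  rw [typeSum_monomial_apply, h, Pi.single_apply]
  simp only [← Nat.Partition.ext_iff, eq_comm]

theorem typeSum_monomial_of_degree_ne {e : Fin n →₀ ℕ} (h : e.degree ≠ d) (c : k) :
    typeSum d (monomial e c) = 0 := by
  ext q
  rw [typeSum_monomial_apply, if_neg fun h' => h (degree_eq_of_monomialType h')]
  rfl

theorem typeSum_rename (σ : Equiv.Perm (Fin n)) (f : MvPolynomial (Fin n) k) :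
    typeSum d (rename σ f) = typeSum d f := by
  have : typeSum (k := k) d ∘ₗ (rename (R := k) σ).toLinearMap = typeSum d := by
    refine (basisMonomials (Fin n) k).ext fun e => ?_
    ext p
    simp [rename_monomial, typeSum_monomial_apply, monomialType_mapDomain]
  exact LinearMap.congr_fun this f

theorem reynolds_apply (f : MvPolynomial (Fin n) k) :
    reynolds f = (n.factorial : k)⁻¹ • ∑ σ : Equiv.Perm (Fin n), rename σ f := by
  simp [reynolds]

theorem typeSum_reynolds (hn : (n.factorial : k) ≠ 0) (f : MvPolynomial (Fin n) k) :
    typeSum d (reynolds f) = typeSum d f := by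
  rw [reynolds_apply, map_smul, map_sum]
  simp only [typeSum_rename, Finset.sum_const, Finset.card_univ, Fintype.card_perm,
    Fintype.card_fin]
  rw [← Nat.cast_smul_eq_nsmul k, smul_smul, inv_mul_cancel₀ hn, one_smul]

theorem reynolds_rename (σ : Equiv.Perm (Fin n)) (f : MvPolynomial (Fin n) k) :
    reynolds (rename σ f) = reynolds f := by
  rw [reynolds_apply, reynolds_apply]
  congr 1
  refine Fintype.sum_equiv (Equiv.mulRight σ) _ _ fun τ => ?_
  rw [rename_rename]
  rfl

theorem rename_reynolds (σ : Equiv.Perm (Fin n)) (f : MvPolynomial (Fin n) k) :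
    rename σ (reynolds f) = reynolds f := by
  rw [reynolds_apply, map_smul, map_sum]
  congr 1
  refine Fintype.sum_equiv (Equiv.mulLeft σ) _ _ fun τ => ?_
  rw [rename_rename]
  rfl

theorem reynolds_mem_Rd {f : MvPolynomial (Fin n) k} (hf : f ∈ Rd k n d) :
    reynolds f ∈ Rd k n d := by
  rw [reynolds_apply]
  exact Submodule.smul_mem _ _ (Submodule.sum_mem _ fun σ _ => rename_mem_Rd hf σ)

theorem coordMap_apply (a : d.Partition → k) :
    coordMap k d n a = ∑ p, a p • reynolds (monomial (partExponent n p) (1 : k)) := by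
  simp [coordMap]

theorem coordMap_single (p : d.Partition) :
    coordMap k d n (Pi.single p 1) = reynolds (monomial (partExponent n p) (1 : k)) := by
  classical
  rw [coordMap_apply, Finset.sum_eq_single p]
  · simp
  · intro q _ hq
    simp [hq]
  · simp

theorem typeSum_coordMap (hdn : d ≤ n) (hn : (n.factorial : k) ≠ 0) (a : d.Partition → k) :
    typeSum d (coordMap k d n a) = a := by
  rw [coordMap_apply, map_sum]
  simp only [map_smul, typeSum_reynolds hn,
    fun p : d.Partition => typeSum_monomial (monomialType_partExponent hdn p) (1 : k)]
  ext p
  simp [Pi.single_apply]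

theorem coordMap_injective (hdn : d ≤ n) (hn : (n.factorial : k) ≠ 0) :
    Function.Injective (coordMap k d n) :=
  Function.LeftInverse.injective (typeSum_coordMap hdn hn)

/-- On a monomial both sides depend only on its orbit, and they agree on the representative `x^λ`.
-/
theorem coordMap_typeSum (hdn : d ≤ n) {f : MvPolynomial (Fin n) k} (hf : f ∈ Rd k n d) :
    coordMap k d n (typeSum d f) = reynolds f := by
  refine eqOn_Rd (coordMap k d n ∘ₗ typeSum d) reynolds (fun e he => ?_) hf
  obtain ⟨p, hp⟩ := exists_partition he
  obtain ⟨σ, hσ⟩ := exists_mapDomain_eq ((monomialType_partExponent hdn p).trans hp.symm)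
  rw [LinearMap.comp_apply, typeSum_monomial hp, coordMap_single, ← hσ, ← rename_monomial,
    reynolds_rename]

theorem coordMap_mem_Rd (hdn : d ≤ n) (a : d.Partition → k) : coordMap k d n a ∈ Rd k n d := by
  rw [coordMap_apply]
  exact Submodule.sum_mem _ fun p _ => Submodule.smul_mem _ _
    (reynolds_mem_Rd (monomial_mem_Rd (degree_partExponent hdn p) _))

theorem coordMap_mem_RdInv (hdn : d ≤ n) (a : d.Partition → k) :
    coordMap k d n a ∈ RdInv k n d := by
  refine ⟨coordMap_mem_Rd hdn a, fun σ => ?_⟩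
  rw [coordMap_apply, map_sum]
  exact Finset.sum_congr rfl fun p _ => by rw [map_smul, rename_reynolds]

theorem reynolds_eq_self (hn : (n.factorial : k) ≠ 0) {f : MvPolynomial (Fin n) k}
    (hf : f ∈ RdInv k n d) : reynolds f = f := by
  have h : ∀ σ : Equiv.Perm (Fin n), rename σ f = f := hf.2
  rw [reynolds_apply]
  simp only [h, Finset.sum_const, Finset.card_univ, Fintype.card_perm, Fintype.card_fin]
  rw [← Nat.cast_smul_eq_nsmul k, smul_smul, inv_mul_cancel₀ hn, one_smul]

theorem coordMap_typeSum_of_mem_RdInv (hdn : d ≤ n) (hn : (n.factorial : k) ≠ 0)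
    {f : MvPolynomial (Fin n) k} (hf : f ∈ RdInv k n d) :
    coordMap k d n (typeSum d f) = f := by
  rw [coordMap_typeSum hdn hf.1, reynolds_eq_self hn hf]

theorem typeSum_hPoly (hdn : d ≤ n) (a : d.Partition → k) : typeSum d (hPoly n a) = a := by
  rw [hPoly, map_sum]
  simp only [fun p : d.Partition => typeSum_monomial (monomialType_partExponent hdn p) (a p)]
  ext p
  simp [Pi.single_apply]

theorem hPoly_mem_Rd (hdn : d ≤ n) (a : d.Partition → k) : hPoly n a ∈ Rd k n d :=
  Submodule.sum_mem _ fun p _ => monomial_mem_Rd (degree_partExponent hdn p) _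

/-- The difference is the average of the `σ · f - f`, each a combination of binomials within orbits.
-/
theorem sub_reynolds_mem (hn : (n.factorial : k) ≠ 0) {W : Submodule k (MvPolynomial (Fin n) k)}
    (h : ∀ (e : Fin n →₀ ℕ), e.degree = d → ∀ σ : Equiv.Perm (Fin n),
      monomial (e.mapDomain σ) (1 : k) - monomial e 1 ∈ W)
    {f : MvPolynomial (Fin n) k} (hf : f ∈ Rd k n d) : reynolds f - f ∈ W := by
  have h1 : ∀ σ : Equiv.Perm (Fin n), rename σ f - f ∈ W := fun σ => by
    have : Rd k n d ≤ W.comap ((rename (R := k) σ).toLinearMap - LinearMap.id) :=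
      Rd_le fun e he => by simpa [rename_monomial] using h e he σ
    exact this hf
  have h2 : reynolds f - f = (n.factorial : k)⁻¹ • ∑ σ : Equiv.Perm (Fin n), (rename σ f - f) := by
    rw [Finset.sum_sub_distrib, smul_sub, ← reynolds_apply]
    simp only [Finset.sum_const, Finset.card_univ, Fintype.card_perm, Fintype.card_fin]
    rw [← Nat.cast_smul_eq_nsmul k, smul_smul, inv_mul_cancel₀ hn, one_smul]
  rw [h2]
  exact Submodule.smul_mem _ _ (Submodule.sum_mem _ fun σ _ => h1 σ)

end Coordinates

/-! ### Macaulay duality in terms of type sums. -/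

section DualityLemmas

variable {k : Type*} [Field k] {n d : ℕ}

theorem contractMonomial_apply (a : Fin n →₀ ℕ) (w : DP k n) (b : Fin n →₀ ℕ) :
    contractMonomial k a w b = w (a + b) := by
  classical
  induction w using Finsupp.induction_linear with
  | zero => simp
  | add f g hf hg => rw [map_add, Finsupp.add_apply, Finsupp.add_apply, hf, hg]
  | single e c =>
    rw [contractMonomial_single]
    split_ifs with h
    · rw [Finsupp.single_apply, Finsupp.single_apply]
      refine if_congr ⟨fun h' => ?_, fun h' => ?_⟩ rfl rfl
      · rw [← h', add_tsub_cancel_of_le h]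
      · rw [h', add_tsub_cancel_left]
    · rw [Finsupp.single_apply, if_neg]
      · rfl
      · rintro rfl
        exact h le_self_add

theorem contraction_monomial (a : Fin n →₀ ℕ) (c : k) :
    contraction k (monomial a c) = c • contractMonomial k a :=
  AddMonoidAlgebra.lift_single _ _ _

theorem contraction_apply (f : MvPolynomial (Fin n) k) (w : DP k n) (b : Fin n →₀ ℕ) :
    contraction k f w b = ∑ a ∈ f.support, coeff a f * w (a + b) := by
  conv_lhs => rw [f.as_sum]
  simp only [map_sum, LinearMap.sum_apply, Finsupp.finsetSum_apply, contraction_monomial,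
    LinearMap.smul_apply, Finsupp.smul_apply, contractMonomial_apply, smul_eq_mul]

theorem typeSum_mul_monomial (f : MvPolynomial (Fin n) k) (b : Fin n →₀ ℕ) :
    typeSum d (f * monomial b 1) =
      ∑ a ∈ f.support, coeff a f • typeSum d (monomial (a + b) (1 : k)) := by
  conv_lhs => rw [f.as_sum]
  simp only [Finset.sum_mul, map_sum, monomial_mul, ← map_smul, smul_eq_mul, mul_one]

/-- The element of `S_{-d}` on which `f ∈ R_d` takes the value `φ (typeSum d f)`. -/
noncomputable def dualForm (n d : ℕ) : Module.Dual k (d.Partition → k) →ₗ[k] DP k n where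
  toFun φ := Finsupp.onFinset (Finsupp.finite_of_degree_eq d).toFinset
    (fun e => φ (typeSum d (monomial e 1))) fun e he => by
      simp only [Set.Finite.mem_toFinset]
      by_contra h
      exact he (by rw [typeSum_monomial_of_degree_ne h, map_zero])
  map_add' φ ψ := by ext e; simp
  map_smul' c φ := by ext e; simp

theorem dualForm_apply (φ : Module.Dual k (d.Partition → k)) (e : Fin n →₀ ℕ) :
    dualForm n d φ e = φ (typeSum d (monomial e 1)) := rfl

theorem contraction_dualForm_apply (f : MvPolynomial (Fin n) k)
    (φ : Module.Dual k (d.Partition → k)) (b : Fin n →₀ ℕ) :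
    contraction k f (dualForm n d φ) b = φ (typeSum d (f * monomial b 1)) := by
  rw [contraction_apply, typeSum_mul_monomial, map_sum]
  simp [dualForm_apply]

/-- The coefficient of the contraction at `b` is `φ` of the type sum of `f · x^b`. For `b ≠ 0` this
product has no term of degree `d`, so only `b = 0` gives a condition. -/
theorem contraction_dualForm_eq_zero_iff {f : MvPolynomial (Fin n) k}
    (hf : ∀ e : Fin n →₀ ℕ, e.degree < d → coeff e f = 0)
    (φ : Module.Dual k (d.Partition → k)) :
    contraction k f (dualForm n d φ) = 0 ↔ φ (typeSum d f) = 0 := by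
  have h0 : f * monomial 0 1 = f := mul_one f
  constructor
  · intro h
    have := DFunLike.congr_fun h 0
    rwa [contraction_dualForm_apply, h0] at this
  · intro h
    ext b
    rw [contraction_dualForm_apply, Finsupp.zero_apply]
    by_cases hb : b = 0
    · rw [hb, h0, h]
    · rw [typeSum_mul_monomial, Finset.sum_eq_zero, map_zero]
      intro a ha
      rw [typeSum_monomial_of_degree_ne, smul_zero]
      intro hab
      rw [map_add] at hab
      have hb' : b.degree ≠ 0 := fun h => hb ((Finsupp.degree_eq_zero_iff b).1 h)
      exact mem_support_iff.1 ha (hf a (by omega))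

theorem dualForm_injective (hdn : d ≤ n) :
    Function.Injective (dualForm (k := k) n d) := by
  classical
  refine (injective_iff_map_eq_zero _).2 fun φ h => ?_
  refine LinearMap.pi_ext' fun p => LinearMap.ext_ring ?_
  have := DFunLike.congr_fun h (partExponent n p)
  rw [dualForm_apply, typeSum_monomial (monomialType_partExponent hdn p)] at this
  simpa using this

theorem dualForm_mem_DPInv (φ : Module.Dual k (d.Partition → k)) :
    dualForm n d φ ∈ DPInv k n d := by
  refine ⟨?_, fun σ => ?_⟩
  · rw [Finsupp.mem_supported']
    intro e he
    rw [dualForm_apply, typeSum_monomial_of_degree_ne he, map_zero]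
  · have hinj : Function.Injective (Finsupp.mapDomain σ : (Fin n →₀ ℕ) → _) :=
      Finsupp.mapDomain_injective σ.injective
    ext e
    have he : e = Finsupp.mapDomain σ (Finsupp.mapDomain σ.symm e) := by
      rw [← Finsupp.mapDomain_comp]
      simp
    rw [Finsupp.lmapDomain_apply]
    conv_lhs => rw [he]
    rw [Finsupp.mapDomain_apply hinj, dualForm_apply, dualForm_apply, ← rename_monomial,
      typeSum_rename]

/-- The coefficients of an invariant are constant on orbits, so its values at the representatives
`x^λ` define the functional. -/
theorem exists_dualForm_eq (hdn : d ≤ n) {w : DP k n} (hw : w ∈ DPInv k n d) :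
    ∃ φ, w = dualForm n d φ := by
  classical
  have hinv : ∀ (σ : Equiv.Perm (Fin n)) e, w (Finsupp.mapDomain σ e) = w e := fun σ e => by
    conv_lhs => rw [← hw.2 σ]
    rw [Finsupp.lmapDomain_apply,
      Finsupp.mapDomain_apply (Finsupp.mapDomain_injective σ.injective)]
  refine ⟨∑ p, w (partExponent n p) • LinearMap.proj p, Finsupp.ext fun e => ?_⟩
  rw [dualForm_apply]
  by_cases he : e.degree = d
  · obtain ⟨p, hp⟩ := exists_partition he
    obtain ⟨σ, rfl⟩ := exists_mapDomain_eq ((monomialType_partExponent hdn p).trans hp.symm)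
    rw [hinv, typeSum_monomial hp]
    simp [Pi.single_apply]
  · rw [typeSum_monomial_of_degree_ne he, map_zero]
    exact (Finsupp.mem_supported' k w).1 hw.1 e he

theorem coeff_eq_zero_of_mem_Rd {f : MvPolynomial (Fin n) k} (hf : f ∈ Rd k n d)
    (e : Fin n →₀ ℕ) (he : e.degree < d) : coeff e f = 0 :=
  IsHomogeneous.coeff_eq_zero hf he.ne

theorem perp_map_coordMap (hdn : d ≤ n) (hn : (n.factorial : k) ≠ 0)
    (A : Submodule k (d.Partition → k)) :
    perp d (A.map (coordMap k d n)) = A.dualAnnihilator.map (dualForm n d) := by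
  have key : ∀ φ a, contraction k (coordMap k d n a) (dualForm n d φ) = 0 ↔ φ a = 0 := by
    intro φ a
    rw [contraction_dualForm_eq_zero_iff (coeff_eq_zero_of_mem_Rd (coordMap_mem_Rd hdn a)),
      typeSum_coordMap hdn hn]
  ext w
  constructor
  · rintro ⟨hw, h⟩
    obtain ⟨φ, rfl⟩ := exists_dualForm_eq hdn hw
    refine ⟨φ, (Submodule.mem_dualAnnihilator φ).2 fun a ha => ?_, rfl⟩
    exact (key φ a).1 (h _ ⟨a, ha, rfl⟩)
  · rintro ⟨φ, hφ, rfl⟩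
    refine ⟨dualForm_mem_DPInv φ, ?_⟩
    rintro _ ⟨a, ha, rfl⟩
    exact (key φ a).2 ((Submodule.mem_dualAnnihilator φ).1 hφ a ha)

theorem mem_annR_DPGe {f : MvPolynomial (Fin n) k} :
    f ∈ annR (DPGe k n d) ↔ ∀ e : Fin n →₀ ℕ, e.degree < d → coeff e f = 0 := by
  classical
  constructor
  · intro h e he
    -- Contracting the single monomial `y^(e)` and reading the constant term recovers the
    -- coefficient of `f` at `e`.
    have h1 := DFunLike.congr_fun (h (Finsupp.single e 1)
      (Finsupp.single_mem_supported k _ he)) 0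
    rw [contraction_apply] at h1
    by_contra hne
    rw [Finset.sum_eq_single e] at h1
    · simp [hne] at h1
    · intro a _ hae
      simp [hae.symm]
    · intro h2
      rw [notMem_support_iff.1 h2, zero_mul]
  · intro h w hw
    ext b
    rw [contraction_apply, Finsupp.zero_apply]
    refine Finset.sum_eq_zero fun a _ => ?_
    by_cases hab : (a + b).degree < d
    · rw [h a (by rw [map_add] at hab; omega), zero_mul]
    · rw [(Finsupp.mem_supported' k w).1 hw _ hab, mul_zero]

theorem mem_annR_sup {N N' : Submodule k (DP k n)} {f : MvPolynomial (Fin n) k} :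
    f ∈ annR (N ⊔ N') ↔ f ∈ annR N ∧ f ∈ annR N' := by
  constructor
  · exact fun h => ⟨fun g hg => h g (Submodule.mem_sup_left hg),
      fun g hg => h g (Submodule.mem_sup_right hg)⟩
  · rintro ⟨h, h'⟩ g hg
    obtain ⟨x, hx, y, hy, rfl⟩ := Submodule.mem_sup.1 hg
    rw [map_add, h x hx, h' y hy, add_zero]

/-- Annihilating `S_{≥ -d+1}` removes the terms below degree `d`; what remains says that every
functional vanishing on `A` kills the type sum, that is, the type sum lies in `A`. -/
theorem mem_Psi_map_coordMap (hdn : d ≤ n) (hn : (n.factorial : k) ≠ 0)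
    {A : Submodule k (d.Partition → k)} {f : MvPolynomial (Fin n) k} :
    f ∈ Psi d (A.map (coordMap k d n)) ↔
      (∀ e : Fin n →₀ ℕ, e.degree < d → coeff e f = 0) ∧ typeSum d f ∈ A := by
  rw [Psi, beta, mem_annR_sup, mem_annR_DPGe, and_comm, perp_map_coordMap hdn hn]
  refine and_congr_right fun hf => ?_
  rw [← Subspace.forall_mem_dualAnnihilator_apply_eq_zero_iff]
  constructor
  · exact fun h φ hφ => (contraction_dualForm_eq_zero_iff hf φ).1 (h _ ⟨φ, hφ, rfl⟩)
  · rintro h _ ⟨φ, hφ, rfl⟩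
    exact (contraction_dualForm_eq_zero_iff hf φ).2 (h φ hφ)

theorem perp_mem_Gr (hdn : d ≤ n) (hn : (n.factorial : k) ≠ 0) {r : ℕ}
    {A : Submodule k (d.Partition → k)} (hA : Module.finrank k A = r) :
    perp d (A.map (coordMap k d n)) ∈ Gr (DPInv k n d) (P d - r) := by
  refine ⟨fun w hw => hw.1, ?_⟩
  have h1 := Subspace.finrank_add_finrank_dualAnnihilator_eq A
  have h2 : Module.finrank k (d.Partition → k) = P d := Module.finrank_fintype_fun_eq_card k
  rw [perp_map_coordMap hdn hn, ← (Submodule.equivMapOfInjective (dualForm n d)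
    (dualForm_injective hdn) A.dualAnnihilator).finrank_eq]
  omega

end DualityLemmas

/-! ### Degree `d` parts of `Phi` and `Psi`. -/

section Ideals

variable {k : Type*} [Field k] {n d : ℕ}

/-- The span of all `σ · f` with `f ∈ V`. -/
noncomputable def orbitSpan (V : Submodule k (MvPolynomial (Fin n) k)) :
    Submodule k (MvPolynomial (Fin n) k) :=
  ⨆ σ : Equiv.Perm (Fin n), V.map (rename (R := k) σ).toLinearMap

theorem rename_mem_orbitSpan_of_mem {V : Submodule k (MvPolynomial (Fin n) k)}
    {f : MvPolynomial (Fin n) k} (hf : f ∈ V) (σ : Equiv.Perm (Fin n)) :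
    rename σ f ∈ orbitSpan V :=
  Submodule.mem_iSup_of_mem σ ⟨f, hf, rfl⟩

theorem le_orbitSpan (V : Submodule k (MvPolynomial (Fin n) k)) : V ≤ orbitSpan V := by
  intro f hf
  simpa using rename_mem_orbitSpan_of_mem hf 1

theorem orbitSpan_le {V S : Submodule k (MvPolynomial (Fin n) k)}
    (h : ∀ (σ : Equiv.Perm (Fin n)), ∀ f ∈ V, rename σ f ∈ S) : orbitSpan V ≤ S :=
  iSup_le fun σ => by
    rintro _ ⟨f, hf, rfl⟩
    exact h σ f hf

theorem rename_mem_orbitSpan {V : Submodule k (MvPolynomial (Fin n) k)}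
    {f : MvPolynomial (Fin n) k} (hf : f ∈ orbitSpan V) (σ : Equiv.Perm (Fin n)) :
    rename σ f ∈ orbitSpan V := by
  have : orbitSpan V ≤ (orbitSpan V).comap (rename (R := k) σ).toLinearMap :=
    orbitSpan_le fun τ f hf => by
      have := rename_mem_orbitSpan_of_mem hf (σ * τ)
      simpa [rename_rename] using this
  exact this hf

theorem orbitSpan_le_Rd {V : Submodule k (MvPolynomial (Fin n) k)} (hV : V ≤ Rd k n d) :
    orbitSpan V ≤ Rd k n d :=
  orbitSpan_le fun σ _ hf => rename_mem_Rd (hV hf) σ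

theorem orbitSpan_le_Phi (V : Submodule k (MvPolynomial (Fin n) k)) :
    orbitSpan V ≤ (Phi V).restrictScalars k :=
  orbitSpan_le fun σ f hf => Ideal.subset_span ⟨σ, f, hf, rfl⟩

theorem homogeneousComponent_mul_of_mem_Rd (a : MvPolynomial (Fin n) k)
    {g : MvPolynomial (Fin n) k} (hg : g ∈ Rd k n d) :
    homogeneousComponent d (a * g) = coeff 0 a • g := by
  classical
  conv_lhs => rw [a.as_sum, Finset.sum_mul, map_sum]
  rw [Finset.sum_eq_single 0]
  · rw [homogeneousComponent_eq_self]
    · rw [smul_eq_C_mul]; rfl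
    · have := (isHomogeneous_C (Fin n) (coeff 0 a)).mul hg
      rwa [zero_add] at this
  · intro e _ he
    have he' : e.degree ≠ 0 := fun h => he ((Finsupp.degree_eq_zero_iff e).1 h)
    rw [homogeneousComponent_of_mem ((isHomogeneous_monomial (coeff e a) rfl).mul hg), if_neg]
    omega
  · intro h
    rw [notMem_support_iff.1 h]
    simp

theorem degreePart_Phi {V : Submodule k (MvPolynomial (Fin n) k)} (hV : V ≤ Rd k n d) :
    degreePart d (Phi V) = orbitSpan V := by
  apply le_antisymm
  · rintro f ⟨hf, hfd⟩
    -- Quantifying over the multiplier `a` makes the claim stable under multiplication by ring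
    -- elements, as induction on the ideal requires.
    have key : ∀ a, homogeneousComponent d (a * f) ∈ orbitSpan V := by
      refine Submodule.span_induction ?_ ?_ ?_ ?_ hf
      · rintro _ ⟨σ, g, hg, rfl⟩ a
        rw [homogeneousComponent_mul_of_mem_Rd a (rename_mem_Rd (hV hg) σ)]
        exact Submodule.smul_mem _ _ (rename_mem_orbitSpan_of_mem hg σ)
      · intro a
        simp
      · intro x y _ _ hx hy a
        rw [mul_add, map_add]
        exact Submodule.add_mem _ (hx a) (hy a)
      · intro b x _ hx a
        rw [smul_eq_mul, ← mul_assoc]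
        exact hx _
    have h1 := key 1
    rwa [one_mul, homogeneousComponent_eq_self hfd] at h1
  · exact le_inf (orbitSpan_le_Phi V) (orbitSpan_le_Rd hV)

theorem map_typeSum_orbitSpan (V : Submodule k (MvPolynomial (Fin n) k)) :
    (orbitSpan V).map (typeSum d) = V.map (typeSum d) := by
  apply le_antisymm
  · rw [Submodule.map_le_iff_le_comap]
    exact orbitSpan_le fun σ f hf => ⟨f, hf, (typeSum_rename σ f).symm⟩
  · exact Submodule.map_mono (le_orbitSpan V)

theorem alpha_eq (hdn : d ≤ n) {V : Submodule k (MvPolynomial (Fin n) k)} (hV : V ≤ Rd k n d) :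
    alpha V = (V.map (typeSum d)).map (coordMap k d n) := by
  rw [← Submodule.map_comp]
  ext g
  constructor
  · rintro ⟨f, hf, rfl⟩
    exact ⟨f, hf, coordMap_typeSum hdn (hV hf)⟩
  · rintro ⟨f, hf, rfl⟩
    exact ⟨f, hf, (coordMap_typeSum hdn (hV hf)).symm⟩

/-- The forms `f` of degree `d` with `typeSum d f ∈ A`. -/
noncomputable def typeComap (n : ℕ) (A : Submodule k (d.Partition → k)) :
    Submodule k (MvPolynomial (Fin n) k) :=
  Rd k n d ⊓ A.comap (typeSum d)

theorem degreePart_Psi (hdn : d ≤ n) (hn : (n.factorial : k) ≠ 0)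
    (A : Submodule k (d.Partition → k)) :
    degreePart d (Psi d (A.map (coordMap k d n))) = typeComap n A := by
  ext f
  constructor
  · rintro ⟨h, hf⟩
    exact ⟨hf, ((mem_Psi_map_coordMap hdn hn).1 h).2⟩
  · rintro ⟨hf, h⟩
    exact ⟨(mem_Psi_map_coordMap hdn hn).2 ⟨coeff_eq_zero_of_mem_Rd hf, h⟩, hf⟩

theorem map_typeSum_typeComap (hdn : d ≤ n) (A : Submodule k (d.Partition → k)) :
    (typeComap n A).map (typeSum d) = A := by
  apply le_antisymm
  · rintro _ ⟨f, hf, rfl⟩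
    exact hf.2
  · intro a ha
    refine ⟨hPoly n a, ⟨hPoly_mem_Rd hdn a, ?_⟩, typeSum_hPoly hdn a⟩
    exact Submodule.mem_comap.2 ((typeSum_hPoly hdn a).symm ▸ ha)

instance finiteDimensional_Rd : FiniteDimensional k (Rd k n d) := by
  have := FiniteDimensional.span_of_finite k
    ((Finsupp.finite_of_degree_eq (σ := Fin n) d).image fun e => monomial e (1 : k))
  exact Submodule.finiteDimensional_of_le (S₂ := Submodule.span k
    ((fun e => monomial e (1 : k)) '' {e : Fin n →₀ ℕ | e.degree = d})) (Rd_le fun e he => Submodule.subset_span ⟨e, he, rfl⟩)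

/-- `typeSum` maps this space onto `A`, with a kernel that does not depend on `A`; the case `A = ⊤`
determines the dimension of the kernel. -/
theorem finrank_typeComap (hdn : d ≤ n) (A : Submodule k (d.Partition → k)) :
    Module.finrank k (typeComap n A) + P d =
      Module.finrank k (Rd k n d) + Module.finrank k A := by
  have h1 : ∀ B : Submodule k (d.Partition → k), Module.finrank k (typeComap n B) =
      Module.finrank k B + Module.finrank k (typeComap n (⊥ : Submodule k (d.Partition → k))) := by
    intro B
    have hfin : FiniteDimensional k (typeComap n B) :=
      Submodule.finiteDimensional_of_le (S₂ := Rd k n d) inf_le_left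
    have := LinearMap.finrank_range_add_finrank_ker ((typeSum d).domRestrict (typeComap n B))
    have hker : ((typeSum d).domRestrict (typeComap n B)).ker =
        (typeComap n (⊥ : Submodule k (d.Partition → k))).comap (typeComap n B).subtype := by
      ext x
      exact ⟨fun h => ⟨x.2.1, h⟩, fun h => h.2⟩
    have hle : typeComap n (⊥ : Submodule k (d.Partition → k)) ≤ typeComap n B :=
      inf_le_inf_left _ (Submodule.comap_mono bot_le)
    rw [← this, LinearMap.range_domRestrict, map_typeSum_typeComap hdn, hker,
      (Submodule.comapSubtypeEquivOfLe hle).finrank_eq]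
  have h2 : typeComap n (⊤ : Submodule k (d.Partition → k)) = Rd k n d := by
    simp [typeComap]
  have h3 := h1 A
  have h4 := h1 ⊤
  have h5 : Module.finrank k (⊤ : Submodule k (d.Partition → k)) = P d := by
    rw [finrank_top, Module.finrank_fintype_fun_eq_card]
    rfl
  rw [h2, h5] at h4
  omega

end Ideals

/-! ### From degree `d` to all higher degrees. -/

section NextDegree

variable {k : Type*} [Field k] {n d : ℕ}

/-- The sum of all coordinates. -/
noncomputable def coordSum (k : Type*) [Field k] (d : ℕ) : (d.Partition → k) →ₗ[k] k :=
  ∑ p, LinearMap.proj p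

theorem coordSum_single (p : d.Partition) (c : k) : coordSum k d (Pi.single p c) = c := by
  simp [coordSum, Pi.single_apply]

theorem exists_eq_add_single {e : Fin n →₀ ℕ} {i : Fin n} (h : e i ≠ 0) :
    ∃ g, e = g + Finsupp.single i 1 :=
  ⟨e - Finsupp.single i 1, (tsub_add_cancel_of_le
    (Finsupp.single_le_iff.2 (Nat.one_le_iff_ne_zero.2 h))).symm⟩

theorem exists_ne_zero_of_degree_ne_zero {e : Fin n →₀ ℕ} (h : e.degree ≠ 0) : ∃ i, e i ≠ 0 := by
  by_contra! hc
  exact h ((Finsupp.degree_eq_zero_iff e).2 (Finsupp.ext hc))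

/-- Modulo an ideal that does not distinguish monomials of degree `d` in the same orbit, all
monomials of degree `d + 1` coincide. -/
theorem mk_monomial_eq_pow (hn3 : 3 ≤ n) (hd : 0 < d) {I : Ideal (MvPolynomial (Fin n) k)}
    (hI : ∀ e : Fin n →₀ ℕ, e.degree = d → ∀ σ : Equiv.Perm (Fin n),
      monomial (e.mapDomain σ) (1 : k) - monomial e 1 ∈ I) (i₀ : Fin n)
    {e : Fin n →₀ ℕ} (he : e.degree = d + 1) :
    Ideal.Quotient.mk I (monomial e 1) = Ideal.Quotient.mk I (X i₀) ^ (d + 1) := by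
  set q : (Fin n →₀ ℕ) → MvPolynomial (Fin n) k ⧸ I :=
    fun e => Ideal.Quotient.mk I (monomial e 1) with hq
  have hadd : ∀ a b, q (a + b) = q a * q b := fun a b => by
    simp only [hq, ← map_mul, monomial_mul, one_mul]
  have hinv : ∀ e : Fin n →₀ ℕ, e.degree = d → ∀ σ : Equiv.Perm (Fin n),
      q (e.mapDomain σ) = q e := fun e he σ => Ideal.Quotient.eq.2 (hI e he σ)
  have hX : ∀ i, q (Finsupp.single i 1) = Ideal.Quotient.mk I (X i) := fun i => rfl
  have hdegX : ∀ i : Fin n, (Finsupp.single i 1 : Fin n →₀ ℕ).degree = 1 := fun i =>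
    Finsupp.degree_single i 1
  -- Write the monomial as `g · x_l` and let `s` swap `i` and `j`. Invariance of the class of `g ·
  -- x_i` turns `x_i` into `x_j` and `g` into `s · g`; invariance of `g · x_l` then turns `s · g`
  -- back into `g`.
  have hshift0 : ∀ f : Fin n →₀ ℕ, f.degree = d → ∀ i j l, l ≠ i → l ≠ j → f l ≠ 0 →
      q f * q (Finsupp.single i 1) = q f * q (Finsupp.single j 1) := by
    intro f hf i j l hli hlj hfl
    obtain ⟨g, rfl⟩ := exists_eq_add_single hfl
    rw [map_add, hdegX] at hf
    have h1 := hinv (g + Finsupp.single i 1) (by rw [map_add, hdegX, hf]) (Equiv.swap i j)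
    have h2 := hinv (g + Finsupp.single l 1) (by rw [map_add, hdegX, hf]) (Equiv.swap i j)
    rw [Finsupp.mapDomain_add, Finsupp.mapDomain_single, Equiv.swap_apply_left, hadd, hadd] at h1
    rw [Finsupp.mapDomain_add, Finsupp.mapDomain_single, Equiv.swap_apply_of_ne_of_ne hli hlj,
      hadd, hadd] at h2
    rw [hadd]
    calc q g * q (Finsupp.single l 1) * q (Finsupp.single i 1)
        = (q g * q (Finsupp.single i 1)) * q (Finsupp.single l 1) := by ring
      _ = (q (g.mapDomain (Equiv.swap i j)) * q (Finsupp.single l 1)) * q (Finsupp.single j 1) := by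
        rw [← h1]; ring
      _ = _ := by rw [h2]
  have hshift : ∀ f : Fin n →₀ ℕ, f.degree = d → ∀ i j,
      q f * q (Finsupp.single i 1) = q f * q (Finsupp.single j 1) := by
    intro f hf i j
    obtain ⟨t, ht⟩ := exists_ne_zero_of_degree_ne_zero (e := f) (by omega)
    -- Here `n ≥ 3` is needed: a variable of the monomial is moved to a third index `l`, which puts
    -- it in the previous situation.
    obtain ⟨l, hl⟩ : ∃ l, l ∉ ({i, j} : Finset (Fin n)) := by
      by_contra! hc
      have h1 : Finset.univ ⊆ ({i, j} : Finset (Fin n)) := fun l _ => hc l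
      have h2 := (Finset.card_le_card h1).trans Finset.card_le_two
      rw [Finset.card_univ, Fintype.card_fin] at h2
      omega
    simp only [Finset.mem_insert, Finset.mem_singleton, not_or] at hl
    rw [← hinv f hf (Equiv.swap t l)]
    refine hshift0 _ (by rw [Finsupp.degree_mapDomain, hf]) i j l hl.1 hl.2 ?_
    rw [Finsupp.mapDomain_equiv_apply]
    simpa using ht
  -- The factors of the monomial are replaced by `x_{i₀}` one at a time; `c` counts those already
  -- replaced.
  have key : ∀ m c, m + c = d + 1 → ∀ g : Fin n →₀ ℕ, g.degree = m →
      q g * q (Finsupp.single i₀ 1) ^ c = q (Finsupp.single i₀ 1) ^ (d + 1) := by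
    intro m
    induction m with
    | zero =>
      intro c hc g hg
      rw [(Finsupp.degree_eq_zero_iff g).1 hg, ← hc, zero_add]
      exact one_mul _
    | succ m ih =>
      intro c hc g hg
      obtain ⟨a, ha⟩ := exists_ne_zero_of_degree_ne_zero (e := g) (by omega)
      obtain ⟨g, rfl⟩ := exists_eq_add_single ha
      rw [map_add, hdegX] at hg
      have hpow : q (Finsupp.single i₀ 1) ^ c = q (Finsupp.single i₀ c) := by
        simp only [hq, ← map_pow, monomial_pow, one_pow]
        simp
      have h1 := hshift (g + Finsupp.single i₀ c)
        (by rw [map_add, Finsupp.degree_single]; omega) a i₀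
      rw [hadd, ← hpow] at h1
      rw [hadd, ← ih (c + 1) (by omega) g (by omega)]
      linear_combination h1
  have := key (d + 1) 0 rfl e he
  rwa [pow_zero, mul_one] at this

/-- Modulo `I` all monomials of degree `d + 1` have one class `z`, so `f · x_{i₀}` becomes the
coefficient sum of `f` times `z`. As `f ∈ I` and the sum is nonzero, `z = 0`. -/
theorem monomial_mem_of_degree_succ (hn3 : 3 ≤ n) (hd : 0 < d)
    {I : Ideal (MvPolynomial (Fin n) k)}
    (hI : ∀ e : Fin n →₀ ℕ, e.degree = d → ∀ σ : Equiv.Perm (Fin n),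
      monomial (e.mapDomain σ) (1 : k) - monomial e 1 ∈ I)
    {f : MvPolynomial (Fin n) k} (hfd : f ∈ Rd k n d) (hfI : f ∈ I)
    (hf : coordSum k d (typeSum d f) ≠ 0) {e : Fin n →₀ ℕ} (he : e.degree = d + 1) :
    monomial e (1 : k) ∈ I := by
  let i₀ : Fin n := ⟨0, by omega⟩
  set z := Ideal.Quotient.mk I (X i₀) ^ (d + 1) with hz
  have h1 : Ideal.Quotient.mk I (f * X i₀) = coordSum k d (typeSum d f) • z := by
    refine eqOn_Rd
      ((Ideal.Quotient.mkₐ k I).toLinearMap ∘ₗ LinearMap.mulRight k (X i₀))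
      ((coordSum k d ∘ₗ typeSum d).smulRight z) (fun e he => ?_) hfd
    obtain ⟨p, hp⟩ := exists_partition he
    have h2 : monomial e (1 : k) * X i₀ = monomial (e + Finsupp.single i₀ 1) 1 := by
      rw [X, monomial_mul, one_mul]
    have h3 := mk_monomial_eq_pow hn3 hd hI i₀ (e := e + Finsupp.single i₀ 1)
      (by rw [map_add, he, Finsupp.degree_single])
    simp only [LinearMap.comp_apply, LinearMap.mulRight_apply, LinearMap.smulRight_apply,
      typeSum_monomial hp, coordSum_single, one_smul, h2]
    exact h3
  rw [Ideal.Quotient.eq_zero_iff_mem.2 (I.mul_mem_right _ hfI)] at h1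
  have h4 : z = 0 := (smul_eq_zero.1 h1.symm).resolve_left hf
  rw [← Ideal.Quotient.eq_zero_iff_mem, mk_monomial_eq_pow hn3 hd hI i₀ he, ← hz, h4]

theorem monomial_mem_of_lt_degree {I : Ideal (MvPolynomial (Fin n) k)}
    (hI : ∀ e : Fin n →₀ ℕ, e.degree = d + 1 → monomial e (1 : k) ∈ I)
    {e : Fin n →₀ ℕ} (he : d < e.degree) (c : k) : monomial e c ∈ I := by
  obtain ⟨g, hg, hgd⟩ := Finsupp.exists_le_degree_eq e (d + 1) he
  have : monomial e c = monomial (e - g) c * monomial g 1 := by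
    rw [monomial_mul, mul_one, tsub_add_cancel_of_le hg]
  rw [this]
  exact I.mul_mem_left _ (hI g hgd)

/-- An element of `Psi` splits into its degree `d` component, which `hW` puts into the orbit span,
and terms of higher degree, which are multiples of monomials of degree `d + 1`. -/
theorem Phi_eq_Psi (hdn : d ≤ n) (hn : (n.factorial : k) ≠ 0)
    {V : Submodule k (MvPolynomial (Fin n) k)} (hV : V ≤ Rd k n d)
    (hW : orbitSpan V = typeComap n (V.map (typeSum d)))
    (hsucc : ∀ e : Fin n →₀ ℕ, e.degree = d + 1 → monomial e (1 : k) ∈ Phi V) :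
    Phi V = Psi d (alpha V) := by
  rw [alpha_eq hdn hV]
  apply le_antisymm
  · rw [Phi, Ideal.span_le]
    rintro _ ⟨σ, f, hf, rfl⟩
    exact (mem_Psi_map_coordMap hdn hn).2
      ⟨coeff_eq_zero_of_mem_Rd (rename_mem_Rd (hV hf) σ), f, hf, (typeSum_rename σ f).symm⟩
  · intro f hf
    obtain ⟨hlow, hA⟩ := (mem_Psi_map_coordMap hdn hn).1 hf
    set g := homogeneousComponent d f with hg
    have hcoeff : ∀ e ∈ (f - g).support, d < e.degree := by
      intro e he
      rw [mem_support_iff, coeff_sub, hg, coeff_homogeneousComponent] at he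
      by_contra hle
      rcases (not_lt.1 hle).lt_or_eq with h | h
      · simp [h.ne, hlow e h] at he
      · simp [h] at he
    have h1 : f - g ∈ Phi V := by
      rw [(f - g).as_sum]
      exact Ideal.sum_mem _ fun e he => monomial_mem_of_lt_degree hsucc (hcoeff e he) _
    have h2 : typeSum d (f - g) = 0 := by
      rw [(f - g).as_sum, map_sum]
      exact Finset.sum_eq_zero fun e he => typeSum_monomial_of_degree_ne (hcoeff e he).ne' _
    rw [map_sub, sub_eq_zero] at h2
    have h3 : g ∈ orbitSpan V := by
      rw [hW]
      exact ⟨homogeneousComponent_isHomogeneous d f, Submodule.mem_comap.2 (h2 ▸ hA)⟩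
    have h4 : g ∈ Phi V := orbitSpan_le_Phi V h3
    simpa using (Phi V).add_mem h1 h4

end NextDegree

/-! ### Isolating binomials with transpositions. -/

section Binomials

variable {k : Type*} [Field k] {n d : ℕ}

theorem mapDomain_swap_eq_self {e : Fin n →₀ ℕ} {i j : Fin n} (h : e i = e j) :
    e.mapDomain (Equiv.swap i j) = e := by
  ext l
  rw [Finsupp.mapDomain_equiv_apply, Equiv.symm_swap, Equiv.swap_apply_def]
  split_ifs with h1 h2
  · rw [h1, h]
  · rw [h2, h]
  · rfl

theorem mapDomain_mul (σ τ : Equiv.Perm (Fin n)) (e : Fin n →₀ ℕ) :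
    e.mapDomain (σ * τ) = (e.mapDomain τ).mapDomain σ := by
  rw [Equiv.Perm.coe_mul, Finsupp.mapDomain_comp]

theorem rename_swap_eq_self {h : MvPolynomial (Fin n) k} {i j : Fin n} (hi : i ∉ h.vars)
    (hj : j ∉ h.vars) : rename (Equiv.swap i j) h = h := by
  refine hom_congr_vars (f₁ := (rename (R := k) (Equiv.swap i j)).toRingHom)
    (f₂ := RingHom.id _) (p₁ := h) (p₂ := h) ?_ (fun l hl _ => ?_) rfl
  · ext; simp
  · have h1 : l ≠ i := fun h => hi (h ▸ hl)
    have h2 : l ≠ j := fun h => hj (h ▸ hl)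
    simp [Equiv.swap_apply_of_ne_of_ne h1 h2]

/-- An admissible binomial whose greatest common divisor lacks only one part moves one exponent
to a new variable. -/
theorem IsAdmissibleBinomial.exists_swap {p : d.Partition} {m m' : Fin n →₀ ℕ}
    (h : IsAdmissibleBinomial p m m') {c : ℕ} (hc : c ∈ p.parts)
    (hg : monomialType (m ⊓ m') = p.parts.erase c) :
    ∃ i j, i ≠ j ∧ m i = c ∧ m j = 0 ∧ m' = m.mapDomain (Equiv.swap i j) := by
  obtain ⟨hne, hm, hm', hd1, hd2⟩ := h
  set g := m ⊓ m' with hgdef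
  have key : ∀ u : Fin n →₀ ℕ, g ≤ u → monomialType u = p.parts →
      Disjoint g.support (u - g).support → ∃ i, u = g + Finsupp.single i c ∧ g i = 0 := by
    intro u hgu hu hdis
    have h1 : g + (u - g) = u := add_tsub_cancel_of_le hgu
    have h2 : monomialType (u - g) = {c} := by
      have h3 := monomialType_add hdis
      rw [h1, hu, hg] at h3
      refine (add_left_cancel (a := p.parts.erase c) ?_).symm
      rw [← h3, add_comm, Multiset.singleton_add, Multiset.cons_erase hc]
    have hcard : (u - g).support.card = 1 := by
      rw [← card_monomialType, h2, Multiset.card_singleton]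
    obtain ⟨i, hi⟩ := Finset.card_eq_one.1 hcard
    have h4 : (u - g) i = c := by
      rw [monomialType, hi] at h2
      simpa using h2
    refine ⟨i, ?_, ?_⟩
    · rw [← h4, ← (Finsupp.support_eq_singleton.1 hi).2, h1]
    · exact Finsupp.notMem_support_iff.1 (Finset.disjoint_right.1 hdis (by simp [hi]))
  obtain ⟨i, hi, hgi⟩ := key m inf_le_left hm hd1
  obtain ⟨j, hj, hgj⟩ := key m' inf_le_right hm' hd2
  have hij : i ≠ j := by
    rintro rfl
    exact hne (hi.trans hj.symm)
  refine ⟨i, j, hij, ?_, ?_, ?_⟩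
  · rw [hi]; simp [hgi]
  · rw [hi]; simp [hgj, hij]
  · rw [hi, hj, Finsupp.mapDomain_add, Finsupp.mapDomain_single, Equiv.swap_apply_left,
      mapDomain_swap_eq_self (hgi.trans hgj.symm)]

theorem two_ne_zero_of_ne (hn : (n.factorial : k) ≠ 0) {i j : Fin n} (hij : i ≠ j) :
    (2 : k) ≠ 0 := by
  intro h2
  have hn2 : 2 ≤ n := by
    by_contra hlt
    exact hij (Fin.ext (by omega))
  obtain ⟨c, hc⟩ := Nat.dvd_factorial two_pos hn2
  exact hn (by rw [hc, Nat.cast_mul, Nat.cast_ofNat, h2, zero_mul])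

/-- The transposition of `i` and `j` negates the binomial `q` and, by disjointness of variables,
fixes `h` and all other binomials. Subtracting leaves twice the binomial `q`, and `2` is invertible.
-/
theorem binomial_mem_of_disjoint (hn : (n.factorial : k) ≠ 0)
    {W : Submodule k (MvPolynomial (Fin n) k)}
    (hW : ∀ (σ : Equiv.Perm (Fin n)), ∀ f ∈ W, rename σ f ∈ W) {ι : Type*} (I : Finset ι)
    (b : ι → (Fin n →₀ ℕ) × (Fin n →₀ ℕ)) {h : MvPolynomial (Fin n) k}
    (hf : h + ∑ q ∈ I, (monomial (b q).1 (1 : k) - monomial (b q).2 1) ∈ W)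
    (hvars : ∀ q ∈ I, Disjoint ((b q).1.support ∪ (b q).2.support) h.vars)
    (hdis : ∀ q ∈ I, ∀ q' ∈ I, q ≠ q' → Disjoint ((b q).1.support ∪ (b q).2.support)
      ((b q').1.support ∪ (b q').2.support))
    {q : ι} (hq : q ∈ I) {i j : Fin n} (hij : i ≠ j) (hi : (b q).1 i ≠ 0)
    (hb : (b q).2 = (b q).1.mapDomain (Equiv.swap i j)) :
    monomial (b q).1 (1 : k) - monomial (b q).2 1 ∈ W := by
  classical
  have hb' : (b q).2.mapDomain (Equiv.swap i j) = (b q).1 := by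
    rw [hb, ← mapDomain_mul, Equiv.swap_mul_self]
    exact Finsupp.mapDomain_id
  have hiS : i ∈ (b q).1.support ∪ (b q).2.support := by simp [hi]
  have hjS : j ∈ (b q).1.support ∪ (b q).2.support := by
    rw [Finset.mem_union]
    right
    rw [hb, Finsupp.mem_support_iff, Finsupp.mapDomain_equiv_apply]
    simpa using hi
  have hother : ∀ q' ∈ I, q' ≠ q →
      (b q').1.mapDomain (Equiv.swap i j) = (b q').1 ∧
        (b q').2.mapDomain (Equiv.swap i j) = (b q').2 := by
    intro q' hq' hne
    have hd := hdis q hq q' hq' hne.symm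
    have h1 := Finset.disjoint_left.1 hd hiS
    have h2 := Finset.disjoint_left.1 hd hjS
    simp only [Finset.mem_union, Finsupp.mem_support_iff, not_or, not_not] at h1 h2
    exact ⟨mapDomain_swap_eq_self (h1.1.trans h2.1.symm),
      mapDomain_swap_eq_self (h1.2.trans h2.2.symm)⟩
  have hh : rename (Equiv.swap i j) h = h :=
    rename_swap_eq_self (Finset.disjoint_left.1 (hvars q hq) hiS)
      (Finset.disjoint_left.1 (hvars q hq) hjS)
  have hmem := W.sub_mem hf (hW (Equiv.swap i j) _ hf)
  have hcalc : h + ∑ q ∈ I, (monomial (b q).1 (1 : k) - monomial (b q).2 1) -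
      rename (Equiv.swap i j) (h + ∑ q ∈ I, (monomial (b q).1 (1 : k) - monomial (b q).2 1)) =
      (2 : k) • (monomial (b q).1 (1 : k) - monomial (b q).2 1) := by
    rw [map_add, hh, add_sub_add_left_eq_sub, map_sum, ← Finset.sum_sub_distrib,
      Finset.sum_eq_single q]
    · rw [map_sub, rename_monomial, rename_monomial, ← hb, hb', two_smul]
      abel
    · intro q' hq' hne
      rw [map_sub, rename_monomial, rename_monomial, (hother q' hq' hne).1,
        (hother q' hq' hne).2, sub_self]
    · exact fun h => absurd hq h
  rw [hcalc] at hmem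
  exact (W.smul_mem_iff (two_ne_zero_of_ne hn hij)).1 hmem

/-- If an invariant subspace contains a binomial that moves the exponent `m i` from `i` to `j`,
then it contains all binomials that move an equal exponent in a monomial of the same type. -/
theorem swap_binomial_mem_of_type_eq {W : Submodule k (MvPolynomial (Fin n) k)}
    (hW : ∀ (σ : Equiv.Perm (Fin n)), ∀ f ∈ W, rename σ f ∈ W) {m m₀ : Fin n →₀ ℕ}
    (htype : monomialType m = monomialType m₀) {i j i₀ j₀ : Fin n} (hi : m i ≠ 0) (hj : m j = 0)
    (hi₀ : m₀ i₀ = m i) (hj₀ : m₀ j₀ = 0)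
    (hmem : monomial m (1 : k) - monomial (m.mapDomain (Equiv.swap i j)) 1 ∈ W) :
    monomial (m₀.mapDomain (Equiv.swap i₀ j₀)) (1 : k) - monomial m₀ 1 ∈ W := by
  obtain ⟨σ, rfl⟩ := exists_mapDomain_eq htype
  have hval : ∀ l, m.mapDomain σ (σ l) = m l := fun l => Finsupp.mapDomain_apply σ.injective _ _
  -- `σ` is corrected so that `i ↦ i₀` and `j ↦ j₀`. The two swaps exchange positions with equal
  -- exponents, so the image of `m` does not change.
  set τ : Equiv.Perm (Fin n) := Equiv.swap (σ j) j₀ * (Equiv.swap (σ i) i₀ * σ) with hτ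
  have hswap1 : (m.mapDomain σ).mapDomain (Equiv.swap (σ i) i₀) = m.mapDomain σ :=
    mapDomain_swap_eq_self (by rw [hval, hi₀])
  have hne1 : σ j ≠ σ i := fun h => hi (σ.injective h ▸ hj)
  have hne2 : σ j ≠ i₀ := fun h => hi (by rw [← hi₀, ← h, hval, hj])
  have hne3 : i₀ ≠ j₀ := fun h => hi (by rw [← hi₀, h, hj₀])
  have hm : m.mapDomain τ = m.mapDomain σ := by
    rw [hτ, mapDomain_mul, mapDomain_mul, hswap1]
    exact mapDomain_swap_eq_self (by rw [hval, hj, hj₀])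
  have hτi : τ i = i₀ := by
    simp [hτ, Equiv.swap_apply_of_ne_of_ne hne2.symm hne3]
  have hτj : τ j = j₀ := by
    simp [hτ, Equiv.swap_apply_of_ne_of_ne hne1 hne2]
  have hconj : τ * Equiv.swap i j = Equiv.swap i₀ j₀ * τ := by
    rw [← hτi, ← hτj, Equiv.mul_swap_eq_swap_mul]
  clear_value τ
  have h1 := hW τ _ hmem
  rw [map_sub, rename_monomial, rename_monomial, ← mapDomain_mul, hconj, mapDomain_mul, hm] at h1
  rw [← neg_sub]
  exact W.neg_mem h1

/-- If an invariant subspace contains all binomials that move an exponent of a monomial of type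
`λ` to a new variable, then it contains all differences of monomials of type `λ`. -/
theorem perm_binomial_mem {W : Submodule k (MvPolynomial (Fin n) k)} {s : Multiset ℕ}
    (hs : s.card < n)
    (hmove : ∀ m : Fin n →₀ ℕ, monomialType m = s → ∀ i j, m i ≠ 0 → m j = 0 →
      monomial (m.mapDomain (Equiv.swap i j)) (1 : k) - monomial m 1 ∈ W)
    {m : Fin n →₀ ℕ} (hm : monomialType m = s) (σ : Equiv.Perm (Fin n)) :
    monomial (m.mapDomain σ) (1 : k) - monomial m 1 ∈ W := by
  have hmove' : ∀ m : Fin n →₀ ℕ, monomialType m = s → ∀ i j, m j = 0 →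
      monomial (m.mapDomain (Equiv.swap i j)) (1 : k) - monomial m 1 ∈ W := by
    intro m hm i j hj
    by_cases hi : m i = 0
    · rw [mapDomain_swap_eq_self (hi.trans hj.symm), sub_self]
      exact W.zero_mem
    · exact hmove m hm i j hi hj
  have hswap : ∀ m : Fin n →₀ ℕ, monomialType m = s → ∀ i j,
      monomial (m.mapDomain (Equiv.swap i j)) (1 : k) - monomial m 1 ∈ W := by
    intro m hm i j
    by_cases hij : i = j
    · rw [hij, mapDomain_swap_eq_self rfl, sub_self]
      exact W.zero_mem
    by_cases hj : m j = 0
    · exact hmove' m hm i j hj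
    by_cases hi : m i = 0
    · rw [Equiv.swap_comm]
      exact hmove' m hm j i hi
    obtain ⟨l, hl⟩ : ∃ l, m l = 0 := by
      by_contra! hc
      have h1 : m.support = Finset.univ := by
        ext l
        simp [hc l]
      have h2 := card_monomialType m
      rw [hm, h1, Finset.card_univ, Fintype.card_fin] at h2
      omega
    have hli : l ≠ i := fun h => hi (h ▸ hl)
    have hlj : l ≠ j := fun h => hj (h ▸ hl)
    -- Two occupied positions are exchanged through a free one: `i` to `l`, then `j` to `i`, then
    -- `l` to `j`. Each of the three is a move to an unoccupied position.
    have hperm : Equiv.swap j l * (Equiv.swap i j * Equiv.swap i l) = Equiv.swap i j := by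
      have h1 : Equiv.swap i j * Equiv.swap i l = Equiv.swap j l * Equiv.swap i j := by
        rw [Equiv.mul_swap_eq_swap_mul, Equiv.swap_apply_left,
          Equiv.swap_apply_of_ne_of_ne hli hlj]
      rw [h1, ← mul_assoc, Equiv.swap_mul_self, one_mul]
    set m₁ := m.mapDomain (Equiv.swap i l) with hm₁
    have ht₁ : monomialType m₁ = s := by rw [hm₁, monomialType_mapDomain, hm]
    have hm₁i : m₁ i = 0 := by
      rw [hm₁, Finsupp.mapDomain_equiv_apply]
      simpa using hl
    set m₂ := m₁.mapDomain (Equiv.swap i j) with hm₂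
    have ht₂ : monomialType m₂ = s := by rw [hm₂, monomialType_mapDomain, ht₁]
    have hm₂j : m₂ j = 0 := by
      rw [hm₂, Finsupp.mapDomain_equiv_apply]
      simpa using hm₁i
    have e1 := hmove' m hm i l hl
    have e2 := hmove' m₁ ht₁ j i hm₁i
    have e3 := hmove' m₂ ht₂ l j hm₂j
    rw [Equiv.swap_comm j i] at e2
    rw [Equiv.swap_comm l j, hm₂, hm₁, ← mapDomain_mul, ← mapDomain_mul, mul_assoc, hperm] at e3
    rw [hm₁] at e2
    simpa using W.add_mem (W.add_mem e1 e2) e3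
  induction σ using Equiv.Perm.swap_induction_on with
  | one =>
    rw [Equiv.Perm.coe_one, Finsupp.mapDomain_id, sub_self]
    exact W.zero_mem
  | swap_mul f x y _ ih =>
    rw [mapDomain_mul]
    have := hswap (m.mapDomain f) (by rw [monomialType_mapDomain, hm]) x y
    simpa using W.add_mem this ih

end Binomials

/-! ### A single form that generates all binomials within orbits. -/

section Generators

variable {k : Type*} [Field k] {n d : ℕ}

/-- The form `f_a = h_a + ∑ b(λ, γ)`, of type sum `a`, generates modulo symmetry all differences of
monomials of degree `d` of the same type. -/
theorem HasBinomials.exists_generator (hdn : d ≤ n) (hd : 0 < d) (hn : (n.factorial : k) ≠ 0)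
    {a : d.Partition → k} {t : d.Partition} (hat : a t ≠ 0) (h : HasBinomials n a t) :
    ∃ f ∈ Rd k n d, typeSum d f = a ∧
      ∀ W : Submodule k (MvPolynomial (Fin n) k),
        (∀ (σ : Equiv.Perm (Fin n)), ∀ f ∈ W, rename σ f ∈ W) → f ∈ W →
        ∀ e : Fin n →₀ ℕ, e.degree = d → ∀ σ : Equiv.Perm (Fin n),
          monomial (e.mapDomain σ) (1 : k) - monomial e 1 ∈ W := by
  classical
  obtain ⟨b, hb, hbdis⟩ := h
  -- Only the `γ` that lack exactly one part of `λ` are used. Their binomials move one exponent to a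
  -- free variable, and one such move for each part value suffices.
  let I : Finset (d.Partition × Multiset ℕ) :=
    (Finset.univ.filter (· ≠ t)).biUnion fun p =>
      p.parts.toFinset.image fun c => (p, p.parts.erase c)
  let B : d.Partition × Multiset ℕ → (Fin n →₀ ℕ) × (Fin n →₀ ℕ) := fun q => b q.1 q.2
  have hImem : ∀ {q}, q ∈ I → q.1 ≠ t ∧ ∃ c ∈ q.1.parts, q.2 = q.1.parts.erase c := by
    intro q hq
    simp only [I, Finset.mem_biUnion, Finset.mem_filter, Finset.mem_univ, true_and,
      Finset.mem_image, Multiset.mem_toFinset] at hq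
    obtain ⟨p, hp, c, hc, rfl⟩ := hq
    exact ⟨hp, c, hc, rfl⟩
  have hmemI : ∀ {p : d.Partition} {c}, p ≠ t → c ∈ p.parts → (p, p.parts.erase c) ∈ I := by
    intro p c hp hc
    simp only [I, Finset.mem_biUnion, Finset.mem_filter, Finset.mem_univ, true_and,
      Finset.mem_image, Multiset.mem_toFinset]
    exact ⟨p, hp, c, hc, rfl⟩
  have hlt : ∀ {q}, q ∈ I → q.2 < q.1.parts := by
    intro q hq
    obtain ⟨-, c, hc, h⟩ := hImem hq
    rw [h]
    exact Multiset.erase_lt.2 hc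
  have hadm : ∀ {q}, q ∈ I → IsAdmissibleBinomial q.1 (B q).1 (B q).2 := fun hq =>
    (hb _ (hImem hq).1 _ (hlt hq)).1
  refine ⟨hPoly n a + ∑ q ∈ I, (monomial (B q).1 (1 : k) - monomial (B q).2 1), ?_, ?_, ?_⟩
  · refine Submodule.add_mem _ (hPoly_mem_Rd hdn a) (Submodule.sum_mem _ fun q hq => ?_)
    exact Submodule.sub_mem _
      (monomial_mem_Rd (degree_eq_of_monomialType (hadm hq).2.1) _)
      (monomial_mem_Rd (degree_eq_of_monomialType (hadm hq).2.2.1) _)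
  · rw [map_add, typeSum_hPoly hdn, map_sum, Finset.sum_eq_zero, add_zero]
    intro q hq
    rw [map_sub, typeSum_monomial (hadm hq).2.1, typeSum_monomial (hadm hq).2.2.1, sub_self]
  · intro W hW hf
    have hother : ∀ p : d.Partition, p ≠ t → ∀ e : Fin n →₀ ℕ, monomialType e = p.parts →
        ∀ σ : Equiv.Perm (Fin n), monomial (e.mapDomain σ) (1 : k) - monomial e 1 ∈ W := by
      intro p hp
      have key : ∀ c ∈ p.parts, ∃ m i j, i ≠ j ∧ monomialType m = p.parts ∧ m i = c ∧ m j = 0 ∧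
          monomial m (1 : k) - monomial (m.mapDomain (Equiv.swap i j)) 1 ∈ W := by
        intro c hc
        have hq := hmemI hp hc
        obtain ⟨i, j, hij, hi, hj, hsw⟩ := (hadm hq).exists_swap hc
          (hb _ (hImem hq).1 _ (hlt hq)).2.1
        have hne : (B (p, p.parts.erase c)).1 i ≠ 0 := by
          rw [hi]
          exact (p.parts_pos hc).ne'
        refine ⟨(B (p, p.parts.erase c)).1, i, j, hij, (hadm hq).2.1, hi, hj, ?_⟩
        rw [← hsw]
        refine binomial_mem_of_disjoint hn hW I B hf
          (fun q hq => (hb _ (hImem hq).1 _ (hlt hq)).2.2) ?_ hq hij hne hsw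
        exact fun q hq q' hq' hne => hbdis _ (hImem hq).1 _ (hlt hq) _ (hImem hq').1 _ (hlt hq') hne
      have hcard : p.parts.card < n := by
        obtain ⟨c, hc⟩ : ∃ c, c ∈ p.parts := by
          refine Multiset.exists_mem_of_ne_zero fun h0 => ?_
          have := p.parts_sum
          rw [h0, Multiset.sum_zero] at this
          omega
        obtain ⟨m, i, j, -, hm, -, hj, -⟩ := key c hc
        rw [← hm, card_monomialType]
        calc m.support.card < (Finset.univ : Finset (Fin n)).card :=
              Finset.card_lt_card (Finset.ssubset_univ_iff.2 fun h => by
                have := Finset.mem_univ j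
                rw [← h, Finsupp.mem_support_iff] at this
                exact this hj)
          _ = n := by simp
      intro e he σ
      refine perm_binomial_mem hcard (fun m₀ hm₀ i₀ j₀ hi₀ hj₀ => ?_) he σ
      have hc : m₀ i₀ ∈ p.parts := by
        rw [← hm₀, monomialType]
        exact Multiset.mem_map.2 ⟨i₀, by simpa using hi₀, rfl⟩
      obtain ⟨m, i, j, -, hm, hi, hj, hmem⟩ := key _ hc
      exact swap_binomial_mem_of_type_eq hW (hm.trans hm₀.symm) (hi ▸ hi₀) hj hi.symm hj₀ hmem
    -- In `σ · f - f` all contributions of types other than `t` are already in `W`; what is left is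
    -- `a t ≠ 0` times the binomial of type `t`.
    have ht : ∀ σ : Equiv.Perm (Fin n), monomial ((partExponent n t).mapDomain σ) (1 : k) -
        monomial (partExponent n t) 1 ∈ W := by
      intro σ
      have h1 := W.sub_mem (hW σ _ hf) hf
      rw [map_add, map_sum, add_sub_add_comm, ← Finset.sum_sub_distrib] at h1
      have h2 : ∑ q ∈ I, (rename σ (monomial (B q).1 (1 : k) - monomial (B q).2 1) -
          (monomial (B q).1 1 - monomial (B q).2 1)) ∈ W := by
        refine Submodule.sum_mem _ fun q hq => ?_
        rw [map_sub, sub_sub_sub_comm, rename_monomial, rename_monomial]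
        exact W.sub_mem (hother _ (hImem hq).1 _ (hadm hq).2.1 σ)
          (hother _ (hImem hq).1 _ (hadm hq).2.2.1 σ)
      have h3 := (W.add_mem_iff_left h2).1 h1
      rw [hPoly, map_sum, ← Finset.sum_sub_distrib,
        ← Finset.add_sum_erase _ _ (Finset.mem_univ t)] at h3
      have h4 : ∀ p : d.Partition, rename σ (monomial (partExponent n p) (a p)) -
          monomial (partExponent n p) (a p) = a p •
          (monomial ((partExponent n p).mapDomain σ) (1 : k) - monomial (partExponent n p) 1) := by
        intro p
        rw [rename_monomial, smul_sub, smul_monomial, smul_monomial, smul_eq_mul, mul_one]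
      simp only [h4] at h3
      rw [W.add_mem_iff_left, W.smul_mem_iff hat] at h3
      · exact h3
      · exact Submodule.sum_mem _ fun p hp => W.smul_mem _
          (hother p (Finset.ne_of_mem_erase hp) _ (monomialType_partExponent hdn p) σ)
    intro e he σ
    obtain ⟨p, hp⟩ := exists_partition he
    by_cases hpt : p = t
    · subst hpt
      obtain ⟨τ, rfl⟩ := exists_mapDomain_eq ((monomialType_partExponent hdn p).trans hp.symm)
      rw [← mapDomain_mul]
      simpa using W.sub_mem (ht (σ * τ)) (ht τ)
    · exact hother p hpt e hp σ

theorem EnoughVariables.exists_hasBinomials (h : EnoughVariables k d n) {a : d.Partition → k}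
    (ha : a ≠ 0) : ∃ t, a t ≠ 0 ∧ HasBinomials n a t := by
  obtain ⟨-, lt, hlt, h⟩ := h
  have hwf : WellFounded lt := Finite.wellFounded_of_trans_of_irrefl lt
  obtain ⟨t, ht, hmin⟩ := hwf.has_min {p | a p ≠ 0} (Function.ne_iff.1 ha)
  exact ⟨t, ht, h a t ht fun p hp => hmin p hp⟩

/-- For `h_a = x^t`, a binomial of another partition exchanges two variables, and neither of them
occurs in `x^t`, which contains a third. -/
theorem EnoughVariables.three_le (h : EnoughVariables k d n) (hP : 1 < P d) : 3 ≤ n := by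
  classical
  have hdn := h.1
  obtain ⟨t, p, hpt⟩ := Fintype.exists_pair_of_one_lt_card hP
  have hd : d ≠ 0 := by
    rintro rfl
    exact hpt (Subsingleton.elim _ _)
  obtain ⟨-, lt, hlt, h⟩ := h
  obtain ⟨b, hb, -⟩ := h (Pi.single t 1) t (by simp) fun q hq => by
    have : q = t := by
      by_contra hne
      simp [hne] at hq
    rw [this]
    exact hlt.toIsStrictOrder.irrefl t
  obtain ⟨c, hc⟩ : ∃ c, c ∈ p.parts := by
    refine Multiset.exists_mem_of_ne_zero fun h0 => ?_
    have := p.parts_sum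
    rw [h0, Multiset.sum_zero] at this
    omega
  obtain ⟨hadm, hg, hvars⟩ := hb p hpt.symm _ (Multiset.erase_lt.2 hc)
  obtain ⟨i, j, hij, hi, -, hsw⟩ := hadm.exists_swap hc hg
  have hi0 := (p.parts_pos hc).ne'
  obtain ⟨l, hl⟩ := exists_ne_zero_of_degree_ne_zero (e := partExponent n t)
    (by rw [degree_partExponent hdn]; exact hd)
  have hlv : l ∈ (hPoly n (Pi.single t (1 : k))).vars := by
    have : hPoly n (Pi.single t (1 : k)) = monomial (partExponent n t) 1 := by
      rw [hPoly, Finset.sum_eq_single t]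
      · simp
      · intro q _ hq
        simp [hq]
      · simp
    rw [this, vars_monomial one_ne_zero]
    simpa using hl
  have hli : l ≠ i := by
    rintro rfl
    refine Finset.disjoint_right.1 hvars hlv (Finset.mem_union_left _ ?_)
    rw [Finsupp.mem_support_iff, hi]
    exact hi0
  have hlj : l ≠ j := by
    rintro rfl
    refine Finset.disjoint_right.1 hvars hlv (Finset.mem_union_right _ ?_)
    rw [hsw, Finsupp.mem_support_iff, Finsupp.mapDomain_equiv_apply]
    simpa [hi] using hi0
  have h3 : ({i, j, l} : Finset (Fin n)).card = 3 := Finset.card_eq_three.2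
    ⟨i, j, l, hij, hli.symm, hlj.symm, rfl⟩
  calc 3 = _ := h3.symm
    _ ≤ Fintype.card (Fin n) := Finset.card_le_univ _
    _ = n := Fintype.card_fin n

end Generators

/-! ### Openness, surjectivity of `alpha` and the general symmetric ideals. -/

section Main

variable {k : Type*} [Field k] {n d r : ℕ}

theorem factorial_ne_zero_of_ringChar (h : ringChar k = 0 ∨ n < ringChar k) :
    (n.factorial : k) ≠ 0 := by
  intro h0
  have hdvd := (ringChar.spec k n.factorial).1 h0
  rcases h with h | h
  · rw [h, zero_dvd_iff] at hdvd
    exact n.factorial_ne_zero hdvd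
  · rcases CharP.char_is_prime_or_zero k (ringChar k) with hp | hp
    · exact absurd ((hp.dvd_factorial).1 hdvd) (not_le.2 h)
    · omega

theorem sub_mem_typeComap {e : Fin n →₀ ℕ} (he : e.degree = d) (σ : Equiv.Perm (Fin n))
    (A : Submodule k (d.Partition → k)) :
    monomial (e.mapDomain σ) (1 : k) - monomial e 1 ∈ typeComap n A := by
  refine ⟨Submodule.sub_mem _
    (monomial_mem_Rd (by rw [Finsupp.degree_mapDomain, he]) _) (monomial_mem_Rd he _), ?_⟩
  refine Submodule.mem_comap.2 ?_
  rw [map_sub, ← rename_monomial, typeSum_rename, sub_self]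
  exact A.zero_mem

theorem orbitSpan_le_typeComap {V : Submodule k (MvPolynomial (Fin n) k)} (hV : V ≤ Rd k n d) :
    orbitSpan V ≤ typeComap n (V.map (typeSum d)) :=
  le_inf (orbitSpan_le_Rd hV) (Submodule.map_le_iff_le_comap.1 (map_typeSum_orbitSpan V).le)

theorem P_le_finrank (hdn : d ≤ n) : P d ≤ Module.finrank k (Rd k n d) := by
  have := finrank_typeComap (k := k) hdn (⊥ : Submodule k (d.Partition → k))
  rw [finrank_bot] at this
  omega

theorem orbitSpan_eq_typeComap (hdn : d ≤ n) (hrP : r ≤ P d)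
    {V : Submodule k (MvPolynomial (Fin n) k)} (hV : V ≤ Rd k n d)
    (hA : Module.finrank k (V.map (typeSum d)) = r)
    (hdim : Module.finrank k (Rd k n d) - (P d - r) ≤ Module.finrank k (orbitSpan V)) :
    orbitSpan V = typeComap n (V.map (typeSum d)) := by
  have h1 := finrank_typeComap hdn (V.map (typeSum d))
  have h2 := P_le_finrank (k := k) hdn
  have hfin : FiniteDimensional k (typeComap n (V.map (typeSum d))) :=
    Submodule.finiteDimensional_of_le (S₂ := Rd k n d) inf_le_left
  exact Submodule.eq_of_le_of_finrank_le (orbitSpan_le_typeComap hV) (by omega)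

theorem Phi_eq_Psi_alpha (hd : 0 < d) (hr : 0 < r) (hrP : r ≤ P d)
    (hn : (n.factorial : k) ≠ 0) (hE : EnoughVariables k d n)
    {V : Submodule k (MvPolynomial (Fin n) k)} (hV : V ≤ Rd k n d)
    (hA : Module.finrank k (V.map (typeSum d)) = r)
    (hdim : Module.finrank k (Rd k n d) - (P d - r) ≤ Module.finrank k (orbitSpan V))
    {f : MvPolynomial (Fin n) k} (hfV : f ∈ V) (hf : coordSum k d (typeSum d f) ≠ 0) :
    Phi V = Psi d (alpha V) := by
  have hW := orbitSpan_eq_typeComap hE.1 hrP hV hA hdim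
  refine Phi_eq_Psi hE.1 hn hV hW fun e he => ?_
  rcases lt_or_ge 1 (P d) with hP | hP
  · refine monomial_mem_of_degree_succ (hE.three_le hP) hd (fun e he σ => ?_) (hV hfV)
      (orbitSpan_le_Phi V (le_orbitSpan V hfV)) hf he
    refine orbitSpan_le_Phi V ?_
    rw [hW]
    exact sub_mem_typeComap he σ _
  -- With at most one partition there may be fewer than three variables. But then `0 < r ≤ P(d)`
  -- forces `r = P(d)`, so `Phi V` already contains every form of degree `d`.
  · have htop : V.map (typeSum d) = ⊤ := by
      refine Submodule.eq_top_of_finrank_eq ?_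
      have : Module.finrank k (d.Partition → k) = P d := Module.finrank_fintype_fun_eq_card k
      omega
    obtain ⟨g, hg, hgd⟩ := Finsupp.exists_le_degree_eq e d (by omega)
    have h1 : monomial e (1 : k) = monomial (e - g) 1 * monomial g 1 := by
      rw [monomial_mul, mul_one, tsub_add_cancel_of_le hg]
    rw [h1]
    refine Ideal.mul_mem_left _ _ (orbitSpan_le_Phi V ?_)
    rw [hW, htop]
    exact ⟨monomial_mem_Rd hgd _, trivial⟩

theorem exists_mem_Gr_of_mem_Gr (hd : 0 < d) (hn : (n.factorial : k) ≠ 0)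
    (hE : EnoughVariables k d n) {A : Submodule k (d.Partition → k)} {a : d.Partition → k}
    (haA : a ∈ A) (ha : a ≠ 0) :
    ∃ V ∈ Gr (Rd k n d) (Module.finrank k A), V.map (typeSum d) = A ∧
      orbitSpan V = typeComap n A := by
  have hdn := hE.1
  obtain ⟨t, hat, hB⟩ := hE.exists_hasBinomials ha
  obtain ⟨f, hfd, hfa, hfW⟩ := hB.exists_generator hdn hd hn hat
  -- a linear section of `typeSum` over `A` that takes the value `f` at `a`
  obtain ⟨φ, hφ⟩ := Module.Projective.exists_dual_eq_one k ha
  let s : (d.Partition → k) →ₗ[k] MvPolynomial (Fin n) k :=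
    coordMap k d n + φ.smulRight (f - coordMap k d n a)
  have hs : ∀ x, typeSum d (s x) = x := fun x => by
    simp [s, typeSum_coordMap hdn hn, hfa]
  have hsa : s a = f := by simp [s, hφ]
  have hsd : ∀ x, s x ∈ Rd k n d := fun x =>
    Submodule.add_mem _ (coordMap_mem_Rd hdn x)
      (Submodule.smul_mem _ _ (Submodule.sub_mem _ hfd (coordMap_mem_Rd hdn a)))
  have hmap : (A.map s).map (typeSum d) = A := by
    rw [← Submodule.map_comp]
    have : typeSum d ∘ₗ s = LinearMap.id := LinearMap.ext hs
    rw [this, Submodule.map_id]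
  have hsR : A.map s ≤ Rd k n d := by
    rintro _ ⟨x, -, rfl⟩
    exact hsd x
  refine ⟨A.map s, ⟨hsR, ?_⟩, hmap, le_antisymm ?_ ?_⟩
  · exact (Submodule.equivMapOfInjective s (Function.LeftInverse.injective hs) A).finrank_eq.symm
  · have := orbitSpan_le_typeComap hsR
    rwa [hmap] at this
  · rintro g ⟨hgd, hgA⟩
    -- The orbit span contains all binomials within orbits, so modulo it a form equals its Reynolds
    -- image. Both `g` and `s (typeSum d g)` have Reynolds image `coordMap (typeSum d g)`, and the
    -- latter form lies in the lifted space.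
    have hW := hfW (orbitSpan (A.map s)) (fun σ f hf => rename_mem_orbitSpan hf σ)
      (le_orbitSpan _ ⟨a, haA, hsa⟩)
    have h1 := sub_reynolds_mem hn hW hgd
    have h2 := sub_reynolds_mem hn hW (hsd (typeSum d g))
    rw [← coordMap_typeSum hdn hgd] at h1
    rw [← coordMap_typeSum hdn (hsd _), hs] at h2
    have h3 : s (typeSum d g) ∈ orbitSpan (A.map s) := le_orbitSpan _ ⟨_, hgA, rfl⟩
    have h4 := Submodule.sub_mem _ (Submodule.add_mem _ h2 h3) h1
    simpa using h4

/-- The `r`-dimensional subspaces of `k^{P(d)}` on which the sum of the coordinates does not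
vanish. -/
def generalGr (k : Type*) [Field k] (d r : ℕ) : Set (Submodule k (d.Partition → k)) :=
  {A | A ∈ Gr ⊤ r ∧ ∃ a ∈ A, coordSum k d a ≠ 0}

theorem generalGr_nonempty (hr : 0 < r) (hrP : r ≤ P d) : (generalGr k d r).Nonempty := by
  classical
  obtain ⟨T, -, hT⟩ := Finset.exists_subset_card_eq (s := (Finset.univ : Finset d.Partition))
    (n := r) hrP
  have hli : LinearIndependent k fun p : T => (Pi.single (p : d.Partition) 1 : d.Partition → k) := by
    have := (Pi.basisFun k d.Partition).linearIndependent.comp _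
      (Subtype.val_injective (p := (· ∈ T)))
    simpa [Function.comp_def] using this
  obtain ⟨p, hp⟩ := Finset.card_pos.1 (hT ▸ hr)
  refine ⟨Submodule.span k (Set.range fun p : T => (Pi.single (p : d.Partition) 1 : d.Partition → k)),
    ⟨le_top, ?_⟩, Pi.single p 1, Submodule.subset_span ⟨⟨p, hp⟩, rfl⟩, ?_⟩
  · rw [finrank_span_eq_card hli, Fintype.card_coe, hT]
  · simp [coordSum_single]

/-- This describes `G` by the nonvanishing of a linear form on `U`, the shape in which openness is
known. -/
theorem image_generalGr (hdn : d ≤ n) (hn : (n.factorial : k) ≠ 0) :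
    Submodule.map (coordMap k d n) '' generalGr k d r =
      {U | U ∈ Gr (RdInv k n d) r ∧ ∃ f ∈ U, (coordSum k d ∘ₗ typeSum d) f ≠ 0} := by
  ext U
  constructor
  · rintro ⟨A, ⟨⟨-, hA⟩, a, ha, ha0⟩, rfl⟩
    refine ⟨⟨?_, ?_⟩, coordMap k d n a, ⟨a, ha, rfl⟩, ?_⟩
    · rintro _ ⟨x, -, rfl⟩
      exact coordMap_mem_RdInv hdn x
    · rw [← hA]
      exact (Submodule.equivMapOfInjective _ (coordMap_injective hdn hn) A).finrank_eq.symm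
    · rwa [LinearMap.comp_apply, typeSum_coordMap hdn hn]
  · rintro ⟨⟨hU, hUr⟩, f, hf, hf0⟩
    have hmap : (U.map (typeSum d)).map (coordMap k d n) = U := by
      ext g
      constructor
      · rintro ⟨_, ⟨x, hx, rfl⟩, rfl⟩
        rw [coordMap_typeSum_of_mem_RdInv hdn hn (hU hx)]
        exact hx
      · intro hg
        exact ⟨_, ⟨g, hg, rfl⟩, coordMap_typeSum_of_mem_RdInv hdn hn (hU hg)⟩
    refine ⟨U.map (typeSum d), ⟨⟨le_top, ?_⟩, typeSum d f, ⟨f, hf, rfl⟩, hf0⟩, hmap⟩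
    rw [← hUr]
    conv_rhs => rw [← hmap]
    exact (Submodule.equivMapOfInjective _ (coordMap_injective hdn hn) _).finrank_eq

/-- The preimage under `Φ` of the set of general symmetric ideals. -/
def generalPreimage (k : Type*) [Field k] (n d r : ℕ) :
    Set (Submodule k (MvPolynomial (Fin n) k)) :=
  {V | V ∈ Gr (Rd k n d) r ∧
    Module.finrank k (Rd k n d) - (P d - r) ≤ Module.finrank k (degreePart d (Phi V)) ∧
    alpha V ∈ Submodule.map (coordMap k d n) '' generalGr k d r}

theorem alpha_mem_image_iff (hdn : d ≤ n) (hn : (n.factorial : k) ≠ 0)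
    {V : Submodule k (MvPolynomial (Fin n) k)} (hV : V ≤ Rd k n d) :
    alpha V ∈ Submodule.map (coordMap k d n) '' generalGr k d r ↔
      V.map (typeSum d) ∈ generalGr k d r := by
  rw [alpha_eq hdn hV]
  exact (Submodule.map_injective_of_injective (coordMap_injective hdn hn)).mem_set_image

/-- Three open conditions are intersected: a large orbit span, type sums of rank at least `r` (hence
exactly `r`, as `dim V = r`), and a nonzero coordinate sum. -/
theorem isZariskiOpen_generalPreimage (hdn : d ≤ n) (hn : (n.factorial : k) ≠ 0) :
    IsZariskiOpen (Rd k n d) r (generalPreimage k n d r) := by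
  have h1 := isZariskiOpen_le_finrank_iSup_map (Rd k n d) r
    (fun σ : Equiv.Perm (Fin n) => (rename (R := k) σ).toLinearMap)
    (Module.finrank k (Rd k n d) - (P d - r))
  have h2 := isZariskiOpen_le_finrank_iSup_map (Rd k n d) r
    (fun _ : Unit => typeSum (k := k) (n := n) d) r
  have h3 := isZariskiOpen_exists_apply_ne_zero (Rd k n d) r (coordSum k d ∘ₗ typeSum d)
  convert (h1.inter h2).inter h3 using 1
  ext V
  constructor
  · rintro ⟨hV, hdim, hα⟩
    rw [degreePart_Phi hV.1] at hdim
    obtain ⟨⟨-, hA⟩, _, ⟨f, hf, rfl⟩, hf0⟩ := (alpha_mem_image_iff hdn hn hV.1).1 hα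
    refine ⟨⟨⟨hV, hdim⟩, hV, ?_⟩, hV, f, hf, hf0⟩
    rw [iSup_unique]
    exact hA.ge
  · rintro ⟨⟨⟨hV, hdim⟩, -, hA⟩, -, f, hf, hf0⟩
    refine ⟨hV, ?_, (alpha_mem_image_iff hdn hn hV.1).2
      ⟨⟨le_top, le_antisymm ?_ ?_⟩, typeSum d f, ⟨f, hf, rfl⟩, hf0⟩⟩
    · rw [degreePart_Phi hV.1]
      exact hdim
    · have : FiniteDimensional k V :=
        Submodule.finiteDimensional_of_le (S₂ := Rd k n d) hV.1
      rw [← hV.2]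
      exact Submodule.finrank_map_le _ _
    · rwa [iSup_unique] at hA

theorem alphaBar_Psi (hdn : d ≤ n) (hn : (n.factorial : k) ≠ 0)
    (A : Submodule k (d.Partition → k)) :
    alphaBar d (Psi d (A.map (coordMap k d n))) = A.map (coordMap k d n) := by
  rw [alphaBar, degreePart_Psi hdn hn, alpha_eq hdn (V := typeComap n A) inf_le_left,
    map_typeSum_typeComap hdn]

end Main

end SymmIdeals

/-! ### Assembly of the theorem. -/

open SymmIdeals

theorem theoremA (k : Type*) [Field k] [Infinite k] (d r : ℕ) (hd : 0 < d) (hr : 0 < r)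
    (hrP : r ≤ SymmIdeals.P d) :
    -- `𝒢` depends on `k`, `d`, `r` only, not on the number `n` of variables
    ∃ 𝒢 : Set (Submodule k (d.Partition → k)),
      SymmIdeals.IsZariskiOpen ⊤ r 𝒢 ∧ 𝒢.Nonempty ∧
      ∀ n : ℕ, (ringChar k = 0 ∨ n < ringChar k) → SymmIdeals.EnoughVariables k d n →
      ∃ (O G : Set (Submodule k (MvPolynomial (Fin n) k))),
        -- `G` is `𝒢`, seen in `Gr(r, R'_d)` through the basis `M_λ` of `R'_d`
        G = Submodule.map (SymmIdeals.coordMap k d n) '' 𝒢 ∧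
        SymmIdeals.IsZariskiOpen (SymmIdeals.RdInv k n d) r G ∧ G.Nonempty ∧
        SymmIdeals.IsZariskiOpen (SymmIdeals.Rd k n d) r O ∧ O.Nonempty ∧
        O = {V | V ∈ SymmIdeals.Gr (SymmIdeals.Rd k n d) r ∧
          Module.finrank k (SymmIdeals.Rd k n d) - (SymmIdeals.P d - r) ≤
            Module.finrank k (SymmIdeals.degreePart d (SymmIdeals.Phi V)) ∧
          SymmIdeals.alpha V ∈ G} ∧
        SymmIdeals.Psi d '' G = SymmIdeals.Phi '' O ∧
        (∀ V ∈ O, SymmIdeals.Phi V = SymmIdeals.Psi d (SymmIdeals.alpha V)) ∧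
        Set.MapsTo SymmIdeals.alpha O G ∧ Set.SurjOn SymmIdeals.alpha O G ∧
        Set.BijOn (SymmIdeals.Psi d) G (SymmIdeals.Psi d '' G) ∧
        Set.InvOn (SymmIdeals.alphaBar d) (SymmIdeals.Psi d) G (SymmIdeals.Psi d '' G) ∧
        O = {V | V ∈ SymmIdeals.Gr (SymmIdeals.Rd k n d) r ∧
          SymmIdeals.Phi V ∈ SymmIdeals.Psi d '' G} ∧
        Set.MapsTo (SymmIdeals.perp d) G
          (SymmIdeals.Gr (SymmIdeals.DPInv k n d) (SymmIdeals.P d - r)) ∧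
        Set.InjOn (SymmIdeals.beta d) (SymmIdeals.perp d '' G) := by
  refine ⟨generalGr k d r, isZariskiOpen_exists_apply_ne_zero ⊤ r (coordSum k d),
    generalGr_nonempty hr hrP, fun n hchar hE => ?_⟩
  have hn := factorial_ne_zero_of_ringChar hchar
  have hdn := hE.1
  set G := Submodule.map (coordMap k d n) '' generalGr k d r with hG
  have hΦ : ∀ V ∈ generalPreimage k n d r, Phi V = Psi d (alpha V) := by
    rintro V ⟨hV, hdim, hα⟩
    rw [degreePart_Phi hV.1] at hdim
    obtain ⟨⟨-, hA⟩, _, ⟨f, hf, rfl⟩, hf0⟩ := (alpha_mem_image_iff hdn hn hV.1).1 hα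
    exact Phi_eq_Psi_alpha hd hr hrP hn hE hV.1 hA hdim hf hf0
  have hmaps : Set.MapsTo alpha (generalPreimage k n d r) G := fun V hV => hV.2.2
  have hdimA : ∀ A ∈ generalGr k d r, Module.finrank k (Rd k n d) - (P d - r) ≤
      Module.finrank k (typeComap n A) := by
    rintro A ⟨⟨-, hA⟩, -⟩
    have := finrank_typeComap hdn A
    omega
  have hsurj : Set.SurjOn alpha (generalPreimage k n d r) G := by
    rintro _ ⟨A, hA, rfl⟩
    obtain ⟨⟨-, hAr⟩, a, ha, ha0⟩ := id hA
    obtain ⟨V, hV, hVA, hW⟩ := exists_mem_Gr_of_mem_Gr hd hn hE ha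
      (fun h => ha0 (by rw [h, map_zero]))
    have hα : alpha V = A.map (coordMap k d n) := by rw [alpha_eq hdn hV.1, hVA]
    refine ⟨V, ⟨hAr ▸ hV, ?_, hα ▸ ⟨A, hA, rfl⟩⟩, hα⟩
    rw [degreePart_Phi hV.1, hW]
    exact hdimA A hA
  have hinv : ∀ U ∈ G, alphaBar d (Psi d U) = U := by
    rintro _ ⟨A, -, rfl⟩
    exact alphaBar_Psi hdn hn A
  have hinj : Set.InjOn (Psi d) G := fun U hU U' hU' h => by
    rw [← hinv U hU, h, hinv U' hU']
  refine ⟨generalPreimage k n d r, G, rfl, ?_, (generalGr_nonempty hr hrP).image _,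
    isZariskiOpen_generalPreimage hdn hn, ?_, rfl, ?_, hΦ, hmaps, hsurj, hinj.bijOn_image,
    ⟨hinv, ?_⟩, ?_, ?_, ?_⟩
  · rw [hG, image_generalGr hdn hn]
    exact isZariskiOpen_exists_apply_ne_zero _ _ _
  · obtain ⟨U, hU⟩ := (generalGr_nonempty (k := k) hr hrP).image (Submodule.map (coordMap k d n))
    obtain ⟨V, hV, -⟩ := hsurj hU
    exact ⟨V, hV⟩
  · apply Set.Subset.antisymm
    · rintro _ ⟨U, hU, rfl⟩
      obtain ⟨V, hV, rfl⟩ := hsurj hU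
      exact ⟨V, hV, hΦ V hV⟩
    · rintro _ ⟨V, hV, rfl⟩
      exact ⟨alpha V, hmaps hV, (hΦ V hV).symm⟩
  · rintro _ ⟨U, hU, rfl⟩
    rw [hinv U hU]
  · ext V
    constructor
    · exact fun hV => ⟨hV.1, alpha V, hmaps hV, (hΦ V hV).symm⟩
    · rintro ⟨hV, _, ⟨A, hA, rfl⟩, h⟩
      -- The degree `d` part of the ideal recovers both its dimension and `typeSum(V) = A`, the two
      -- conditions that define `O`.
      have hdeg : degreePart d (Phi V) = typeComap n A := by
        rw [← h, degreePart_Psi hdn hn]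
      have hVA : V.map (typeSum d) = A := by
        rw [← map_typeSum_orbitSpan V, ← degreePart_Phi hV.1, hdeg, map_typeSum_typeComap hdn]
      refine ⟨hV, hdeg ▸ hdimA A hA, (alpha_mem_image_iff hdn hn hV.1).2 (hVA ▸ hA)⟩
  · rintro _ ⟨A, hA, rfl⟩
    exact perp_mem_Gr hdn hn hA.1.2
  -- `Psi` is by definition `beta` after `perp`, so its injectivity on `G` carries over to `beta` on
  -- the image.
  · rintro _ ⟨U, hU, rfl⟩ _ ⟨U', hU', rfl⟩ h
    rw [hinj hU hU' h]
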